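/- **Setting.** Let $G=(V,\mathcal E)$ be a finite simple graph with $n=|V|$ vertices and let $p\in(0,1)$. For a subgraph $G'\subset G$, let $G'_p$ be the random subgraph of $G'$ obtained by retaining each edge of $G'$ independently with probability $p$. For a vertex $v$ of $G'$ and an integer $k\ge 1$, let $B_p(v,k;G')$ and $\partial B_p(v,k;G')$ be the sets of vertices in the connected component of $v$ in $G'_p$ whose graph distance from $v$ in $G'_p$ is at most $k$, respectively exactly $k$, and let $\mathcal E(B_p(v,k;G'))$ be the set of edges of $G'_p$ with both ends in $B_p(v,k;G')$. Let $\mathbf{CO}(G_p)$ be the set of connected components of $G_p$; for $\mathcal C\in\mathbf{CO}(G_p)$ let $|\mathcal C|$ be its number of vertices, $\mathcal E(\mathcal C)$ its edge set, $\operatorname{diam}(\mathcal C)$ its diameter in the graph distance, and $T_{\rm mix}(\mathcal C)=\min\{t\in\mathbb{Z}_{\ge 0}:\|\mathbf p^t(x,\cdot)-\pi\|_{TV}\le 1/4\ \text{for all vertices } x\text{ of }\mathcal C\}$ the mixing time of the lazy simple random walk on $\mathcal C$, where $\mathbf p(x,x)=\frac12$, $\mathbf p(x,y)=\frac1{2\deg(x)}$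 for adjacent $x,y$ and $\pi(x)=\deg(x)/(2|\mathcal E(\mathcal C)|)$, degrees being taken in $\mathcal C$ (for a one-vertex component, $T_{\rm mix}=0$). **Theorem 2.1.** For all $c_1,c_2,\beta>0$ there is a constant $K=K(c_1,c_2,\beta)>0$ such that the following holds. Let $G$ be a finite simple graph on $n$ vertices and $p\in(0,1)$, and suppose that for every subgraph $G'\subset G$, every vertex $v$ of $G'$ and every integer $k\ge1$, 1. $\mathbb E\,|\mathcal E(B_p(v,k;G'))|\le c_1k$, and 2. $\mathbf P(\partial B_p(v,k;G')\neq\emptyset)\le c_2/k$. Then for every real $A>0$: - (a) if $\beta n^{2/3}\ge 1$, then $\mathbf P\big(\exists\,\mathcal C\in\mathbf{CO}(G_p)$ with $|\mathcal C|>\beta n^{2/3}$ and $\operatorname{diam}(\mathcal C)\notin[A^{-1}n^{1/3},An^{1/3}]\big)\le KA^{-1}$; - (b) $\mathbf P\big(\exists\,\mathcal C\in\mathbf{CO}(G_p)$ with $|\mathcal E(\mathcal C)|>An^{2/3}\big)\le KA^{-1}$; - (c.1) $\mathbf P\big(\exists\,\mathcal C\in\mathbf{CO}(G_p)$ with $|\mathcal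 C|>\beta n^{2/3}$ and $T_{\rm mix}(\mathcal C)>An\big)\le KA^{-1/2}$; - (c.2) if $\beta n^{2/3}\ge 1$, then $\mathbf P\big(\exists\,\mathcal C\in\mathbf{CO}(G_p)$ with $|\mathcal C|>\beta n^{2/3}$ and $T_{\rm mix}(\mathcal C)<A^{-1}n\big)\le KA^{-1/13}$. -/

import Mathlib

open MeasureTheory ProbabilityTheory

noncomputable section

namespace CriticalPercolation

/-! ### Bond percolation -/

/-- The law of the bond percolation subgraph `G_p`: every edge of `G` is retained with probability
`p` and erased with probability `1 - p`, independently of the other edges. (All subgraphs carry the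
full vertex set.) -/
def percolation {V : Type*} (G : SimpleGraph V) (p : unitInterval) : Measure (SimpleGraph V) :=
  (setBernoulli G.edgeSet p).map SimpleGraph.fromEdgeSet

instance {V : Type*} [Countable V] (G : SimpleGraph V) (p : unitInterval) :
    IsProbabilityMeasure (percolation G p) :=
  Measure.isProbabilityMeasure_map SimpleGraph.measurable_fromEdgeSet.aemeasurable

/-- `P(G_p ∈ S)`. -/
def percProb {V : Type*} (G : SimpleGraph V) (p : unitInterval) (S : Set (SimpleGraph V)) : ℝ :=
  (percolation G p).real S

/-- `E f(G_p)`. It is used for finite vertex sets only, where every `f` is integrable. -/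
def percExp {V : Type*} (G : SimpleGraph V) (p : unitInterval) (f : SimpleGraph V → ℝ) : ℝ :=
  ∫ H, f H ∂(percolation G p)

/-! ### Balls, spheres and edge sets -/

/-- `B(v, k)`: the vertices of the connected component of `v` at distance at most `k` from `v`. -/
def ball {V : Type*} (H : SimpleGraph V) (v : V) (k : ℕ) : Set V :=
  {u | H.Reachable v u ∧ H.dist v u ≤ k}

/-- `∂B(v, k)`: the vertices of the connected component of `v` at distance exactly `k` from `v`. -/
def sphere {V : Type*} (H : SimpleGraph V) (v : V) (k : ℕ) : Set V :=
  {u | H.Reachable v u ∧ H.dist v u = k}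

/-- The edges of `H` which have both ends in `B`. -/
def edgesIn {V : Type*} (H : SimpleGraph V) (B : Set V) : Set (Sym2 V) :=
  {e | e ∈ H.edgeSet ∧ ∀ x ∈ e, x ∈ B}

/-! ### The lazy simple random walk and its mixing time -/

/-- The degree of a vertex. -/
def deg {W : Type*} (H : SimpleGraph W) (x : W) : ℕ :=
  (H.neighborSet x).ncard

open Classical in
/-- The transition matrix of the lazy simple random walk on `H`: stay put with probability `1/2`,
otherwise move to a uniform neighbour. At an isolated vertex, which has nowhere to move to, the
walk stays put. -/
def lazyWalk {W : Type*} (H : SimpleGraph W) : Matrix W W ℝ :=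
  Matrix.of fun x y =>
    if x = y then (if deg H x = 0 then 1 else 1 / 2)
    else if H.Adj x y then 1 / (2 * (deg H x : ℝ)) else 0

open Classical in
/-- The stationary distribution `π(x) = deg(x) / (2|E|)` of the walk on a connected graph. A
connected graph without edges is a single vertex, and then `π(x) = 1`. -/
def stationary {W : Type*} (H : SimpleGraph W) (x : W) : ℝ :=
  if H.edgeSet = ∅ then 1 else (deg H x : ℝ) / (2 * (H.edgeSet.ncard : ℝ))

/-- Total variation distance `max_{A ⊆ W} |μ(A) - ν(A)|`, for `μ`, `ν` given by their weights on a
finite set. -/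
def tvDist {W : Type*} [Fintype W] (μ ν : W → ℝ) : ℝ :=
  ⨆ A : Finset W, |∑ x ∈ A, μ x - ∑ x ∈ A, ν x|

open Classical in
/-- The mixing time `T_mix(H) = T_mix(H, 1/4)` of the lazy simple random walk on the finite connected
graph `H`, i.e. the least `t` with `‖p^t(x, ·) - π‖_TV ≤ 1/4` for all `x`. -/
def mixingTime {W : Type*} [Fintype W] (H : SimpleGraph W) : ℕ :=
  sInf {t : ℕ | ∀ x : W, tvDist (fun y => (lazyWalk H ^ t) x y) (stationary H) ≤ 1 / 4}

/-! ### Components -/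

/-- The number of vertices of a component. -/
def compCard {V : Type*} {H : SimpleGraph V} (C : H.ConnectedComponent) : ℕ :=
  C.supp.ncard

/-- The number of edges of a component. -/
def compEdges {V : Type*} {H : SimpleGraph V} (C : H.ConnectedComponent) : ℕ :=
  (edgesIn H C.supp).ncard

/-- The diameter of a component, seen as a graph of its own. -/
def compDiam {V : Type*} {H : SimpleGraph V} (C : H.ConnectedComponent) : ℕ :=
  C.toSimpleGraph.diam

open Classical in
/-- The mixing time of the lazy simple random walk on a component, seen as a graph of its own. -/
def compMix {V : Type*} [Fintype V] {H : SimpleGraph V} (C : H.ConnectedComponent) : ℕ :=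
  mixingTime C.toSimpleGraph

end CriticalPercolation

end

/-! Except for the edge count, all estimates come from one first moment bound. A component with more
than `M = β n^(2/3)` vertices, all of them bad, supplies more than `M` bad vertices, so it exists
with probability at most `n δ / M` if each vertex is bad with probability at most `δ`
(`percProb_exists_component_le`). It remains to find bad events of probability of order `n^(-1/3)`.

Diameter: in a component of large diameter every vertex survives to half the diameter; in one of
small diameter every vertex has a small ball with too many edges.

Edges: count ordered adjacent pairs lying in oversized components. The state of an edge is
independent of the others, expected degrees are at most `c₁`, and once the edge is deleted one of
its ends must still have a cluster of about half the size. That has probability of order `M^(-1/2)`,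
which yields `n M^(-3/2)`.

Upper bound for mixing: `T_mix ≤ 64 |E| diam` on every connected graph with at least two vertices
(`mixingTime_le`). The return weights of the lazy walk are nonnegative and decreasing, the truncated
Green function `h` at `x` has energy at most `4 h(x)`, and effective resistance is at most the
diameter, so the return weight at time `T` is at most `4 diam / T`. Cauchy-Schwarz turns this into
total variation.

Lower bound for mixing: a function supported on a quarter of the stationary mass has Rayleigh
quotient at least of order `1 / T_mix`. The test function `laneFun` is `1` on `B(v, 2q)`, `0` off
`B(v, 4q)`, and varies only along lanes, the edges leading to vertices that survive another `q`
steps. Hence `q² · shellCard ≤ T_mix · lanes` (`shellCard_mul_le_compMix_mul`). By the domain Markov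
property (`percExp_survival_le`) the expected number of lanes is bounded, and a surviving cluster
rarely has thin shells. This is where the hypotheses are needed for all subgraphs. -/

noncomputable section

namespace CriticalPercolation

/-! ### Expectation under percolation as a finite sum -/

section Expectation
open Classical

variable {V : Type*} [Fintype V]

/-- The edges of a finite graph. -/
def edges (G : SimpleGraph V) : Finset (Sym2 V) :=
  Finset.univ.filter (· ∈ G.edgeSet)

theorem mem_edges {G : SimpleGraph V} {e : Sym2 V} : e ∈ edges G ↔ e ∈ G.edgeSet := by
  simp [edges]

instance : MeasurableSingletonClass (SimpleGraph V) where
  measurableSet_singleton H := by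
    have : ({H} : Set (SimpleGraph V)) = SimpleGraph.edgeSet ⁻¹' {H.edgeSet} := by
      ext K
      simp
    rw [this]
    exact SimpleGraph.measurable_edgeSet (measurableSet_singleton _)

/-- The expectation of a function of `G_p`, as a finite sum over the sets of retained edges. -/
theorem percExp_eq_sum (G : SimpleGraph V) (p : unitInterval) (f : SimpleGraph V → ℝ) :
    percExp G p f = ∑ s ∈ (edges G).powerset,
      (p : ℝ) ^ s.card * (1 - p : ℝ) ^ (edges G \ s).card *
        f (SimpleGraph.fromEdgeSet (s : Set (Sym2 V))) := by
  have hf : ∀ g : SimpleGraph V → ℝ, Measurable g := fun g => by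
    exact measurable_of_finite g
  unfold percExp percolation
  rw [integral_map SimpleGraph.measurable_fromEdgeSet.aemeasurable
    (hf f).aestronglyMeasurable]
  rw [integral_fintype (.of_finite)]
  have h0 : ∀ s : Set (Sym2 V), ¬ s ⊆ G.edgeSet →
      (setBernoulli G.edgeSet p).real {s} = 0 := fun s hs => by
    simp [measureReal_def, setBernoulli_singleton_of_not_subset p hs]
  symm
  refine Finset.sum_of_injOn (fun s : Finset (Sym2 V) => (s : Set (Sym2 V)))
    (fun a _ b _ h => by simpa using h) (fun _ _ => by simp) ?_ ?_
  · intro s _ hs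
    rw [h0 s, zero_smul]
    intro hss
    apply hs
    refine ⟨s.toFinset, ?_, by simp⟩
    simp only [Finset.coe_powerset, Set.mem_preimage, Set.mem_powerset_iff]
    intro e he
    exact mem_edges.2 (hss (by simpa using he))
  · intro s hs
    have hs' : (s : Set (Sym2 V)) ⊆ G.edgeSet := by
      rw [Finset.mem_powerset] at hs
      intro e he
      exact mem_edges.1 (hs he)
    rw [setBernoulli_real_singleton p hs' (Set.toFinite _), smul_eq_mul, Set.ncard_coe_finset]
    congr 3
    rw [← Set.ncard_coe_finset]
    congr 1
    ext e
    simp [mem_edges]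

theorem fromEdgeSet_le_of_mem_powerset {G : SimpleGraph V} {s : Finset (Sym2 V)}
    (hs : s ∈ (edges G).powerset) : SimpleGraph.fromEdgeSet (s : Set (Sym2 V)) ≤ G := by
  intro a b hab
  rw [SimpleGraph.fromEdgeSet_adj] at hab
  have := Finset.mem_powerset.1 hs hab.1
  exact mem_edges.1 this

variable {G : SimpleGraph V} {p : unitInterval} {f g : SimpleGraph V → ℝ}

/-- Only subgraphs of `G` carry mass, so the comparison is needed for `H ≤ G` alone. -/
theorem percExp_mono (h : ∀ H ≤ G, f H ≤ g H) : percExp G p f ≤ percExp G p g := by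
  rw [percExp_eq_sum, percExp_eq_sum]
  refine Finset.sum_le_sum fun s hs => mul_le_mul_of_nonneg_left
    (h _ (fromEdgeSet_le_of_mem_powerset hs)) ?_
  exact mul_nonneg (pow_nonneg p.2.1 _) (pow_nonneg (sub_nonneg.2 p.2.2) _)

theorem percExp_congr (h : ∀ H ≤ G, f H = g H) : percExp G p f = percExp G p g :=
  le_antisymm (percExp_mono fun H hH => (h H hH).le) (percExp_mono fun H hH => (h H hH).ge)

theorem percExp_add : percExp G p (fun H => f H + g H) = percExp G p f + percExp G p g := by
  simp only [percExp_eq_sum, mul_add, Finset.sum_add_distrib]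

theorem percExp_const_mul (c : ℝ) : percExp G p (fun H => c * f H) = c * percExp G p f := by
  simp only [percExp_eq_sum, Finset.mul_sum]
  exact Finset.sum_congr rfl fun _ _ => by ring

theorem percExp_mul_const (c : ℝ) : percExp G p (fun H => f H * c) = percExp G p f * c := by
  simp only [percExp_eq_sum, Finset.sum_mul]
  exact Finset.sum_congr rfl fun _ _ => by ring

theorem percExp_sum {ι : Type*} (s : Finset ι) (F : ι → SimpleGraph V → ℝ) :
    percExp G p (fun H => ∑ i ∈ s, F i H) = ∑ i ∈ s, percExp G p (F i) := by
  simp only [percExp_eq_sum, Finset.mul_sum]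
  exact Finset.sum_comm

theorem percExp_const (c : ℝ) : percExp G p (fun _ => c) = c := by
  simp [percExp]

theorem percProb_eq_percExp (S : Set (SimpleGraph V)) :
    percProb G p S = percExp G p (fun H => if H ∈ S then 1 else 0) := by
  have hS : MeasurableSet S := S.toFinite.measurableSet
  have := integral_indicator_one (μ := percolation G p) hS
  unfold percProb percExp
  rw [← this]
  congr 1

theorem percProb_le_one (S : Set (SimpleGraph V)) : percProb G p S ≤ 1 := by
  unfold percProb
  exact measureReal_le_one

theorem percProb_mono {S T : Set (SimpleGraph V)} (h : ∀ H ≤ G, H ∈ S → H ∈ T) :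
    percProb G p S ≤ percProb G p T := by
  rw [percProb_eq_percExp, percProb_eq_percExp]
  refine percExp_mono fun H hH => ?_
  by_cases h1 : H ∈ S
  · simp [h1, h H hH h1]
  · simp only [h1, if_false]
    split_ifs <;> norm_num

theorem percProb_le_add {S T U : Set (SimpleGraph V)} (h : ∀ H ≤ G, H ∈ S → H ∈ T ∨ H ∈ U) :
    percProb G p S ≤ percProb G p T + percProb G p U := by
  rw [percProb_eq_percExp, percProb_eq_percExp, percProb_eq_percExp, ← percExp_add]
  refine percExp_mono fun H hH => ?_
  by_cases h1 : H ∈ S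
  · rcases h H hH h1 with h2 | h2
    · simp only [h1, h2, if_true]
      split_ifs <;> norm_num
    · simp only [h1, h2, if_true]
      split_ifs <;> norm_num
  · simp only [h1, if_false]
    split_ifs <;> norm_num

theorem percProb_eq_zero {S : Set (SimpleGraph V)} (h : ∀ H ≤ G, H ∉ S) :
    percProb G p S = 0 := by
  rw [percProb_eq_percExp, percExp_congr (g := fun _ => 0), percExp_const]
  intro H hH
  simp [h H hH]

/-- Markov's inequality. -/
theorem percProb_le_div {S : Set (SimpleGraph V)} {a : ℝ} (ha : 0 < a)
    (h0 : ∀ H ≤ G, 0 ≤ f H) (h : ∀ H ≤ G, H ∈ S → a ≤ f H) :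
    percProb G p S ≤ percExp G p f / a := by
  rw [le_div_iff₀ ha, percProb_eq_percExp, ← percExp_mul_const]
  refine percExp_mono fun H hH => ?_
  by_cases h1 : H ∈ S
  · simpa [h1] using h H hH h1
  · simpa [h1] using h0 H hH

/-- The states of edge-disjoint subgraphs are independent. -/
theorem percExp_sup {G₁ G₂ : SimpleGraph V} (hd : Disjoint G₁ G₂) (f : SimpleGraph V → ℝ) :
    percExp (G₁ ⊔ G₂) p f = percExp G₁ p (fun H₁ => percExp G₂ p (fun H₂ => f (H₁ ⊔ H₂))) := by
  have hde : Disjoint (edges G₁) (edges G₂) := by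
    rw [Finset.disjoint_left]
    intro e h1 h2
    rw [mem_edges] at h1 h2
    exact Set.disjoint_left.1 (SimpleGraph.disjoint_edgeSet.2 hd) h1 h2
  have hE : edges (G₁ ⊔ G₂) = edges G₁ ∪ edges G₂ := by
    ext e
    simp [mem_edges]
  simp only [percExp_eq_sum, Finset.mul_sum]
  rw [← Finset.sum_product']
  symm
  refine Finset.sum_bij (fun x _ => x.1 ∪ x.2) ?_ ?_ ?_ ?_
  · rintro ⟨s, t⟩ hst
    simp only [Finset.mem_product, Finset.mem_powerset] at hst ⊢
    rw [hE]
    exact Finset.union_subset_union hst.1 hst.2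
  · rintro ⟨s, t⟩ hst ⟨s', t'⟩ hst' h
    simp only [Finset.mem_product, Finset.mem_powerset] at hst hst' h
    have key : ∀ a b : Finset (Sym2 V), a ⊆ edges G₁ → b ⊆ edges G₂ →
        (a ∪ b) ∩ edges G₁ = a ∧ (a ∪ b) ∩ edges G₂ = b := by
      intro a b ha hb
      rw [Finset.disjoint_left] at hde
      constructor
      · ext e
        simp only [Finset.mem_inter, Finset.mem_union]
        exact ⟨fun h => h.1.resolve_right fun h' => hde h.2 (hb h'), fun h => ⟨.inl h, ha h⟩⟩
      · ext e
        simp only [Finset.mem_inter, Finset.mem_union]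
        exact ⟨fun h => h.1.resolve_left fun h' => hde (ha h') h.2, fun h => ⟨.inr h, hb h⟩⟩
    have k1 := key s t hst.1 hst.2
    have k2 := key s' t' hst'.1 hst'.2
    rw [h] at k1
    ext1
    · exact k1.1.symm.trans k2.1
    · exact k1.2.symm.trans k2.2
  · intro u hu
    rw [Finset.mem_powerset, hE] at hu
    refine ⟨(u ∩ edges G₁, u ∩ edges G₂), ?_, ?_⟩
    · simp [Finset.inter_subset_right]
    · simp only
      rw [← Finset.inter_union_distrib_left, Finset.inter_eq_left.2 hu]
  · rintro ⟨s, t⟩ hst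
    simp only [Finset.mem_product, Finset.mem_powerset] at hst ⊢
    have hst' : Disjoint s t := hde.mono hst.1 hst.2
    have hsd : edges (G₁ ⊔ G₂) \ (s ∪ t) =
        (edges G₁ \ s) ∪ (edges G₂ \ t) := by
      rw [hE]
      rw [Finset.disjoint_left] at hde
      ext e
      simp only [Finset.mem_sdiff, Finset.mem_union]
      constructor
      · rintro ⟨h1 | h1, h2⟩
        · exact .inl ⟨h1, fun h => h2 (.inl h)⟩
        · exact .inr ⟨h1, fun h => h2 (.inr h)⟩
      · rintro (⟨h1, h2⟩ | ⟨h1, h2⟩)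
        · exact ⟨.inl h1, fun h => h.elim h2 fun h => hde h1 (hst.2 h)⟩
        · exact ⟨.inr h1, fun h => h.elim (fun h => hde (hst.1 h) h1) h2⟩
    have hd2 : Disjoint (edges G₁ \ s) (edges G₂ \ t) :=
      hde.mono Finset.sdiff_subset Finset.sdiff_subset
    rw [hsd, Finset.card_union_of_disjoint hst', Finset.card_union_of_disjoint hd2, pow_add,
      pow_add, Finset.coe_union, SimpleGraph.fromEdgeSet_union]
    ring

end Expectation

/-! ### Balls, spheres and the edges that determine them -/

section Balls

variable {V : Type*} {H K : SimpleGraph V} {u v w : V} {i k : ℕ}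

theorem mem_ball_iff_exists_walk : u ∈ ball H v k ↔ ∃ w : H.Walk v u, w.length ≤ k := by
  constructor
  · rintro ⟨h1, h2⟩
    obtain ⟨w, hw⟩ := h1.exists_walk_length_eq_dist
    exact ⟨w, hw ▸ h2⟩
  · rintro ⟨w, hw⟩
    exact ⟨w.reachable, (SimpleGraph.dist_le w).trans hw⟩

@[simp] theorem ball_zero : ball H v 0 = {v} := by
  ext u
  rw [mem_ball_iff_exists_walk, Set.mem_singleton_iff]
  constructor
  · rintro ⟨w, hw⟩
    exact (SimpleGraph.Walk.eq_of_length_eq_zero (Nat.le_zero.1 hw)).symm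
  · rintro rfl
    exact ⟨.nil, by simp⟩

theorem ball_mono_radius (h : i ≤ k) : ball H v i ⊆ ball H v k :=
  fun _ hu => ⟨hu.1, hu.2.trans h⟩

theorem self_mem_ball : v ∈ ball H v k := ⟨.rfl, by simp⟩

theorem ball_mono_graph (h : H ≤ K) : ball H v k ⊆ ball K v k := by
  intro u hu
  obtain ⟨w, hw⟩ := mem_ball_iff_exists_walk.1 hu
  exact mem_ball_iff_exists_walk.2 ⟨w.mapLe h, by simpa using hw⟩

theorem mem_ball_of_adj (hu : u ∈ ball H v k) (huw : H.Adj u w) : w ∈ ball H v (k + 1) := by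
  obtain ⟨q, hq⟩ := mem_ball_iff_exists_walk.1 hu
  exact mem_ball_iff_exists_walk.2 ⟨q.concat huw, by simpa using hq⟩

theorem mem_ball_succ :
    u ∈ ball H v (k + 1) ↔ u ∈ ball H v k ∨ ∃ w ∈ ball H v k, H.Adj w u := by
  constructor
  · intro hu
    obtain ⟨q, hq⟩ := mem_ball_iff_exists_walk.1 hu
    cases hq' : q.reverse with
    | nil => exact .inl self_mem_ball
    | cons h r =>
      right
      refine ⟨_, mem_ball_iff_exists_walk.2 ⟨r.reverse, ?_⟩, h.symm⟩
      have := congrArg SimpleGraph.Walk.length hq'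
      simp only [SimpleGraph.Walk.length_reverse, SimpleGraph.Walk.length_cons] at this ⊢
      omega
  · rintro (h | ⟨w, hw, h⟩)
    · exact ball_mono_radius (Nat.le_succ k) h
    · exact mem_ball_of_adj hw h

theorem mem_sphere_succ : u ∈ sphere H v (k + 1) ↔ u ∈ ball H v (k + 1) ∧ u ∉ ball H v k := by
  simp only [sphere, ball, Set.mem_ofPred_eq]
  constructor
  · rintro ⟨h1, h2⟩
    exact ⟨⟨h1, h2.le⟩, fun h => by omega⟩
  · rintro ⟨⟨h1, h2⟩, h3⟩
    refine ⟨h1, ?_⟩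
    by_contra h
    exact h3 ⟨h1, by omega⟩

theorem dist_le_succ_of_adj (hu : H.Reachable v u) (huw : H.Adj u w) :
    H.dist v w ≤ H.dist v u + 1 :=
  (mem_ball_of_adj (k := H.dist v u) ⟨hu, le_rfl⟩ huw).2

/-- A vertex at distance at least `k` forces the sphere of radius `k` to be nonempty. -/
theorem sphere_nonempty_of_le_dist (hu : H.Reachable v u) (hk : k ≤ H.dist v u) :
    (sphere H v k).Nonempty := by
  obtain ⟨m, hm⟩ : ∃ m, m = H.dist v u := ⟨_, rfl⟩
  induction m generalizing u with
  | zero => exact ⟨u, hu, by omega⟩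
  | succ m ih =>
    rcases hk.eq_or_lt with h | h
    · exact ⟨u, hu, h.symm⟩
    · have h1 : u ∈ ball H v (m + 1) := ⟨hu, hm.ge⟩
      rcases mem_ball_succ.1 h1 with h2 | ⟨w, hw, hwu⟩
      · exact absurd h2.2 (by omega)
      · have := dist_le_succ_of_adj hw.1 hwu
        have h3 := hw.2
        exact ih hw.1 (by omega) (by omega)

/-- The edges of `H` with at least one end in `S`. -/
def touching (H : SimpleGraph V) (S : Set V) : SimpleGraph V where
  Adj a b := H.Adj a b ∧ (a ∈ S ∨ b ∈ S)
  symm := ⟨fun _ _ h => ⟨h.1.symm, h.2.symm⟩⟩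
  loopless := ⟨fun _ h => h.1.ne rfl⟩

/-- The edges of `H` with no end in `S`. -/
def avoiding (H : SimpleGraph V) (S : Set V) : SimpleGraph V where
  Adj a b := H.Adj a b ∧ a ∉ S ∧ b ∉ S
  symm := ⟨fun _ _ h => ⟨h.1.symm, h.2.2, h.2.1⟩⟩
  loopless := ⟨fun _ h => h.1.ne rfl⟩

theorem avoiding_le (H : SimpleGraph V) (S : Set V) : avoiding H S ≤ H := fun _ _ h => h.1

theorem touching_sup_avoiding (H : SimpleGraph V) (S : Set V) :
    touching H S ⊔ avoiding H S = H := by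
  ext a b
  simp only [SimpleGraph.sup_adj, touching, avoiding]
  tauto

theorem disjoint_touching_avoiding (H : SimpleGraph V) (S : Set V) :
    Disjoint (touching H S) (avoiding H S) := by
  rw [disjoint_iff]
  ext a b
  simp only [SimpleGraph.inf_adj, touching, avoiding, SimpleGraph.bot_adj]
  tauto

/-- Recovers the explored half of a configuration from its union with the unexplored half. -/
theorem touching_sup_eq {S : Set V} {G H₁ H₂ : SimpleGraph V} (h₁ : H₁ ≤ touching G S)
    (h₂ : H₂ ≤ avoiding G S) : touching (H₁ ⊔ H₂) S = H₁ := by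
  ext a b
  have h1 := @h₁ a b
  have h2 := @h₂ a b
  simp only [SimpleGraph.sup_adj, touching, avoiding] at h1 h2 ⊢
  tauto

theorem avoiding_sup_eq {S : Set V} {G H₁ H₂ : SimpleGraph V} (h₁ : H₁ ≤ touching G S)
    (h₂ : H₂ ≤ avoiding G S) : avoiding (H₁ ⊔ H₂) S = H₂ := by
  ext a b
  have h1 := @h₁ a b
  have h2 := @h₂ a b
  simp only [SimpleGraph.sup_adj, touching, avoiding] at h1 h2 ⊢
  tauto

/-- The edges touching the ball of radius `i` determine all balls of radius at most `i + 1`. -/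
theorem ball_touching {S : Set V} (h : ball H v i = S ∨ ball (touching H S) v i = S) :
    ∀ k ≤ i + 1, ball (touching H S) v k = ball H v k := by
  intro k hk
  induction k with
  | zero => simp
  | succ k ih =>
    have ih := ih (by omega)
    have hS : ball H v k ⊆ S := by
      rcases h with h | h
      · rw [← h]; exact ball_mono_radius (by omega)
      · rw [← ih]; nth_rw 2 [← h]; exact ball_mono_radius (by omega)
    ext u
    rw [mem_ball_succ, mem_ball_succ, ih]
    refine or_congr_right ⟨?_, ?_⟩
    · rintro ⟨w, hw, hwu⟩
      exact ⟨w, hw, hwu.1⟩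
    · rintro ⟨w, hw, hwu⟩
      exact ⟨w, hw, hwu, .inl (hS hw)⟩

theorem ball_touching_ball (hk : k ≤ i + 1) :
    ball (touching H (ball H v i)) v k = ball H v k :=
  ball_touching (.inl rfl) k hk

theorem sphere_touching_ball :
    sphere (touching H (ball H v i)) v (i + 1) = sphere H v (i + 1) := by
  ext u
  rw [mem_sphere_succ, mem_sphere_succ, ball_touching_ball le_rfl, ball_touching_ball (by omega)]

/-- The event that the ball equals `S` depends only on the edges touching `S`. This is the stopping
property behind the exploration argument. -/
theorem ball_touching_eq_iff {S : Set V} : ball (touching H S) v i = S ↔ ball H v i = S :=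
  ⟨fun h => (ball_touching (.inr h) i (by omega)).symm.trans h,
    fun h => (ball_touching (.inl h) i (by omega)).trans h⟩

end Balls

/-! ### Domain Markov property -/

section Exploration
open Classical

variable {V : Type*} [Fintype V]

/-- Domain Markov property: given the edges touching the ball of radius `i`, the remaining edges
form a percolation on the rest of the graph, where a given vertex survives for another `s` steps
with probability at most `c`. -/
theorem percExp_survival_le {G : SimpleGraph V} {p : unitInterval} {v : V} {i s : ℕ} {c : ℝ}
    (hs : ∀ (S : Set V) (y : V),
      percProb (avoiding G S) p {H | (sphere H y s).Nonempty} ≤ c)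
    (W : SimpleGraph V → V → ℝ) (hW0 : ∀ H y, 0 ≤ W H y)
    (hW : ∀ H y, W (touching H (ball H v i)) y = W H y) :
    percExp G p (fun H => ∑ y, W H y *
        if (sphere (avoiding H (ball H v i)) y s).Nonempty then 1 else 0) ≤
      c * percExp G p (fun H => ∑ y, W H y) := by
  -- Split according to the value `S` of the ball. For fixed `S` the indicator involves only the
  -- edges touching `S`, which are independent of the rest.
  have hdec : ∀ F : SimpleGraph V → Set V → ℝ,
      percExp G p (fun H => F H (ball H v i)) =
        ∑ S : Set V, percExp (touching G S) p (fun H₁ =>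
          percExp (avoiding G S) p (fun H₂ =>
            if ball H₁ v i = S then F (H₁ ⊔ H₂) S else 0)) := by
    intro F
    have h1 : ∀ H : SimpleGraph V, F H (ball H v i) =
        ∑ S : Set V, if ball H v i = S then F H S else 0 := by
      intro H
      simp
    simp_rw [h1]
    rw [percExp_sum]
    refine Finset.sum_congr rfl fun S _ => ?_
    conv_lhs => rw [← touching_sup_avoiding G S]
    rw [percExp_sup (disjoint_touching_avoiding G S)]
    refine percExp_congr fun H₁ h₁ => percExp_congr fun H₂ h₂ => ?_
    have h3 : (ball H₁ v i = S) = (ball (H₁ ⊔ H₂) v i = S) := by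
      rw [← ball_touching_eq_iff (H := H₁ ⊔ H₂), touching_sup_eq h₁ h₂]
    simp only [h3]
  rw [hdec (fun H S => ∑ y, W H y *
        if (sphere (avoiding H S) y s).Nonempty then 1 else 0),
    hdec (fun H _ => ∑ y, W H y), Finset.mul_sum]
  refine Finset.sum_le_sum fun S _ => ?_
  rw [← percExp_const_mul]
  refine percExp_mono fun H₁ h₁ => ?_
  by_cases hb : ball H₁ v i = S
  · simp only [hb, if_true]
    have hWS : ∀ H₂ ≤ avoiding G S, ∀ y, W (H₁ ⊔ H₂) y = W H₁ y := by
      intro H₂ h₂ y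
      have h3 : ball (H₁ ⊔ H₂) v i = S := by
        rw [← ball_touching_eq_iff, touching_sup_eq h₁ h₂, hb]
      rw [← hW (H₁ ⊔ H₂) y, h3, touching_sup_eq h₁ h₂]
    have e1 : percExp (avoiding G S) p (fun H₂ => ∑ y, W (H₁ ⊔ H₂) y) = ∑ y, W H₁ y := by
      rw [percExp_congr (g := fun _ => ∑ y, W H₁ y)
        fun H₂ h₂ => Finset.sum_congr rfl fun y _ => hWS H₂ h₂ y, percExp_const]
    rw [e1, percExp_congr (g := fun H₂ => ∑ y, W H₁ y *
      if H₂ ∈ {H | (sphere H y s).Nonempty} then 1 else 0)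
      (fun H₂ h₂ => Finset.sum_congr rfl fun y _ => by
        rw [hWS H₂ h₂ y, avoiding_sup_eq h₁ h₂]; rfl), percExp_sum, Finset.mul_sum]
    refine Finset.sum_le_sum fun y _ => ?_
    rw [percExp_const_mul, ← percProb_eq_percExp, mul_comm c]
    exact mul_le_mul_of_nonneg_left (hs S y) (hW0 _ _)
  · simp [hb, percExp_const]

end Exploration

/-! ### Positive reversible operators -/

section ReversibleMatrix
open Classical Matrix

variable {W : Type*} [Fintype W]

/-- The inner product of functions on `W` with weights `d`. -/
def wInner (d f g : W → ℝ) : ℝ := ∑ x, d x * (f x * g x)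

variable {d f g h : W → ℝ} {P : Matrix W W ℝ}

theorem wInner_comm : wInner d f g = wInner d g f := by
  simp only [wInner, mul_comm (f _)]

theorem wInner_sub_left : wInner d (f - g) h = wInner d f h - wInner d g h := by
  simp only [wInner, ← Finset.sum_sub_distrib, Pi.sub_apply]
  exact Finset.sum_congr rfl fun _ _ => by ring

theorem wInner_sub_right : wInner d f (g - h) = wInner d f g - wInner d f h := by
  rw [wInner_comm, wInner_sub_left, wInner_comm, wInner_comm (f := h)]

theorem wInner_sum_right {ι : Type*} (s : Finset ι) (F : ι → W → ℝ) :
    wInner d f (∑ i ∈ s, F i) = ∑ i ∈ s, wInner d f (F i) := by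
  simp only [wInner, Finset.sum_apply, Finset.mul_sum]
  exact Finset.sum_comm

theorem wInner_self_nonneg (hd : ∀ x, 0 ≤ d x) : 0 ≤ wInner d f f :=
  Finset.sum_nonneg fun x _ => mul_nonneg (hd x) (mul_self_nonneg _)

theorem wInner_mulVec_comm (hP : ∀ x y, d x * P x y = d y * P y x) :
    wInner d (P *ᵥ f) g = wInner d f (P *ᵥ g) := by
  simp only [wInner, mulVec, dotProduct, Finset.sum_mul, Finset.mul_sum]
  rw [Finset.sum_comm]
  refine Finset.sum_congr rfl fun x _ => Finset.sum_congr rfl fun y _ => ?_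
  calc d y * (P y x * f x * g y) = d y * P y x * f x * g y := by ring
    _ = d x * (f x * (P x y * g y)) := by rw [← hP x y]; ring

theorem weight_mul_pow_comm (hP : ∀ x y, d x * P x y = d y * P y x) (t : ℕ) :
    ∀ x y, d x * (P ^ t) x y = d y * (P ^ t) y x := by
  induction t with
  | zero =>
    intro x y
    by_cases h : x = y
    · rw [h]
    · simp [Matrix.one_apply_ne h, Matrix.one_apply_ne (Ne.symm h)]
  | succ t ih =>
    intro x y
    rw [pow_succ, Matrix.mul_apply, ← pow_succ, pow_succ', Matrix.mul_apply, Finset.mul_sum,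
      Finset.mul_sum]
    refine Finset.sum_congr rfl fun z _ => ?_
    rw [← mul_assoc, ih x z, mul_right_comm, hP z y]
    ring

/-- A reversible matrix whose quadratic form takes values between `0` and the squared norm. -/
structure IsLazyReversible (d : W → ℝ) (P : Matrix W W ℝ) : Prop where
  weight_nonneg : ∀ x, 0 ≤ d x
  reversible : ∀ x y, d x * P x y = d y * P y x
  nonneg : ∀ f, 0 ≤ wInner d (P *ᵥ f) f
  le_self : ∀ f, wInner d (P *ᵥ f) f ≤ wInner d f f

namespace IsLazyReversible

theorem wInner_pow_add (hP : IsLazyReversible d P) (s t : ℕ) :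
    wInner d (P ^ (s + t) *ᵥ f) g = wInner d (P ^ t *ᵥ f) (P ^ s *ᵥ g) := by
  rw [pow_add, ← Matrix.mulVec_mulVec,
    wInner_mulVec_comm (weight_mul_pow_comm hP.reversible s)]

/-- Reversibility moves half of the power to the other side: a squared norm remains for even `t`,
the quadratic form of `P` for odd `t`. -/
theorem wInner_pow_nonneg (hP : IsLazyReversible d P) (t : ℕ) :
    0 ≤ wInner d (P ^ t *ᵥ f) f := by
  rcases Nat.even_or_odd' t with ⟨s, rfl | rfl⟩
  · rw [two_mul, hP.wInner_pow_add]
    exact wInner_self_nonneg hP.weight_nonneg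
  · rw [show 2 * s + 1 = s + (s + 1) by ring, hP.wInner_pow_add, pow_succ',
      ← Matrix.mulVec_mulVec]
    exact hP.nonneg _

/-- The return weights `⟨P ^ t f, f⟩` are convex in `t`. -/
theorem wInner_pow_convex (hP : IsLazyReversible d P) (t : ℕ) :
    wInner d (P ^ (t + 1) *ᵥ f) f - wInner d (P ^ (t + 2) *ᵥ f) f ≤
      wInner d (P ^ t *ᵥ f) f - wInner d (P ^ (t + 1) *ᵥ f) f := by
  have h := hP.wInner_pow_nonneg (f := f - P *ᵥ f) t
  have h1 : wInner d (P ^ t *ᵥ f) (P *ᵥ f) = wInner d (P ^ (t + 1) *ᵥ f) f := by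
    rw [add_comm t 1, hP.wInner_pow_add 1 t, pow_one]
  have h2 : P ^ t *ᵥ (P *ᵥ f) = P ^ (t + 1) *ᵥ f := by
    rw [Matrix.mulVec_mulVec, pow_succ]
  have h3 : wInner d (P ^ (t + 1) *ᵥ f) (P *ᵥ f) = wInner d (P ^ (t + 2) *ᵥ f) f := by
    rw [show t + 2 = 1 + (t + 1) by ring, hP.wInner_pow_add 1 (t + 1), pow_one]
  rw [Matrix.mulVec_sub, wInner_sub_left, wInner_sub_right, wInner_sub_right, h2, h1, h3] at h
  linarith

/-- With `g = P ^ s f`, even times are the bound `le_self` at `g`. At odd times, positivity of the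
form at `g - P g` is combined with `le_self` at `P g`. -/
theorem wInner_pow_succ_le (hP : IsLazyReversible d P) (t : ℕ) :
    wInner d (P ^ (t + 1) *ᵥ f) f ≤ wInner d (P ^ t *ᵥ f) f := by
  rcases Nat.even_or_odd' t with ⟨s, rfl | rfl⟩
  · rw [show 2 * s + 1 = s + (s + 1) by ring, two_mul, hP.wInner_pow_add s (s + 1),
      hP.wInner_pow_add s s, pow_succ' P s, ← Matrix.mulVec_mulVec]
    exact hP.le_self _
  · rw [show 2 * s + 1 + 1 = s + (s + 1 + 1) by ring, show 2 * s + 1 = s + (s + 1) by ring,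
      hP.wInner_pow_add s (s + 1 + 1), hP.wInner_pow_add s (s + 1), pow_succ' P (s + 1), pow_succ' P s,
      ← Matrix.mulVec_mulVec, ← Matrix.mulVec_mulVec]
    generalize P ^ s *ᵥ f = g
    have h1 := hP.le_self (P *ᵥ g)
    have h2 := hP.nonneg (g - P *ᵥ g)
    have h3 : wInner d g (P *ᵥ g) = wInner d (P *ᵥ g) g := wInner_comm
    have h4 : wInner d (P *ᵥ (P *ᵥ g)) g = wInner d (P *ᵥ g) (P *ᵥ g) :=
      wInner_mulVec_comm hP.reversible
    rw [Matrix.mulVec_sub, wInner_sub_left, wInner_sub_right, wInner_sub_right] at h2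
    linarith

theorem wInner_pow_antitone (hP : IsLazyReversible d P) :
    Antitone fun t : ℕ => wInner d (P ^ t *ᵥ f) f :=
  antitone_nat_of_succ_le fun t => hP.wInner_pow_succ_le t

/-- By convexity no decrement exceeds the first one, so the sequence stays above its initial tangent
line. -/
theorem wInner_sub_mul_le (hP : IsLazyReversible d P) (t : ℕ) :
    wInner d f f - t * (wInner d f f - wInner d (P *ᵥ f) f) ≤ wInner d (P ^ t *ᵥ f) f := by
  have hstep : ∀ t : ℕ, wInner d (P ^ t *ᵥ f) f - wInner d (P ^ (t + 1) *ᵥ f) f ≤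
      wInner d f f - wInner d (P *ᵥ f) f := by
    intro t
    induction t with
    | zero => simp
    | succ t ih => exact (hP.wInner_pow_convex t).trans ih
  induction t with
  | zero => simp
  | succ t ih =>
    have := hstep t
    push_cast
    linarith

/-- If `P ^ t` maps every point of `B` into `B` with weight at most `1 / 2`, then functions
supported in `B` have a Rayleigh quotient of at least `1 / (2 t)`. -/
theorem wInner_le_of_pow_le_half (hP : IsLazyReversible d P) {B : Set W} {t : ℕ}
    (hnn : ∀ x y, 0 ≤ (P ^ t) x y) (hf : ∀ x, x ∉ B → f x = 0)
    (hB : ∀ x, ∑ y with y ∈ B, (P ^ t) x y ≤ 1 / 2) :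
    wInner d f f ≤ 2 * t * (wInner d f f - wInner d (P *ᵥ f) f) := by
  have h1 := hP.wInner_sub_mul_le (f := f) t
  have hsym := weight_mul_pow_comm hP.reversible t
  have hone : ∑ x, ∑ y, d x * (P ^ t) x y * (if y ∈ B then f x ^ 2 else 0) ≤
      1 / 2 * wInner d f f := by
    rw [wInner, Finset.mul_sum]
    refine Finset.sum_le_sum fun x _ => ?_
    have : ∑ y, d x * (P ^ t) x y * (if y ∈ B then f x ^ 2 else 0) =
        d x * (f x * f x) * ∑ y with y ∈ B, (P ^ t) x y := by
      rw [Finset.sum_filter, Finset.mul_sum]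
      refine Finset.sum_congr rfl fun y _ => ?_
      split_ifs <;> ring
    rw [this, mul_comm (1 / 2 : ℝ)]
    exact mul_le_mul_of_nonneg_left (hB x) (mul_nonneg (hP.weight_nonneg x) (mul_self_nonneg _))
  -- Reversibility of `P ^ t` exchanges the roles of `x` and `y`.
  have htwo : ∑ x, ∑ y, d x * (P ^ t) x y * (if x ∈ B then f y ^ 2 else 0) ≤
      1 / 2 * wInner d f f := by
    refine le_trans (le_of_eq ?_) hone
    rw [Finset.sum_comm]
    refine Finset.sum_congr rfl fun x _ => Finset.sum_congr rfl fun y _ => ?_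
    rw [hsym y x]
  have h2 : wInner d (P ^ t *ᵥ f) f ≤ 1 / 2 * wInner d f f := by
    have h3 : wInner d (P ^ t *ᵥ f) f = ∑ x, ∑ y, d x * (P ^ t) x y * (f x * f y) := by
      simp only [wInner, mulVec, dotProduct, Finset.sum_mul, Finset.mul_sum]
      exact Finset.sum_congr rfl fun x _ => Finset.sum_congr rfl fun y _ => by ring
    -- `f x * f y` is at most the mean of the two squares, and it vanishes unless both points lie in
    -- `B`, so the indicators cost nothing.
    have h4 : wInner d (P ^ t *ᵥ f) f ≤
        ∑ x, ∑ y, (d x * (P ^ t) x y * (if y ∈ B then f x ^ 2 else 0) / 2 +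
          d x * (P ^ t) x y * (if x ∈ B then f y ^ 2 else 0) / 2) := by
      rw [h3]
      refine Finset.sum_le_sum fun x _ => Finset.sum_le_sum fun y _ => ?_
      rw [← add_div, ← mul_add, mul_div_assoc]
      refine mul_le_mul_of_nonneg_left ?_ (mul_nonneg (hP.weight_nonneg x) (hnn x y))
      by_cases hx : x ∈ B
      · by_cases hy : y ∈ B
        · simp only [hx, hy, if_true]
          nlinarith [sq_nonneg (f x - f y)]
        · simp only [hf y hy, hx, hy, if_true, if_false]
          norm_num
      · simp only [hf x hx, hx, if_false]
        split_ifs <;> norm_num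
    simp only [Finset.sum_add_distrib, ← Finset.sum_div] at h4
    linarith
  linarith

end IsLazyReversible

end ReversibleMatrix

/-! ### The lazy walk as a positive reversible operator -/

section LazyWalk
open Classical Matrix

variable {W : Type*} {K : SimpleGraph W}

/-- The weights of the reversing measure. -/
def degW (K : SimpleGraph W) (x : W) : ℝ := deg K x

theorem degW_mul_lazyWalk (hd : ∀ x, 0 < deg K x) (x y : W) :
    degW K x * lazyWalk K x y =
      if x = y then degW K x / 2 else if K.Adj x y then 1 / 2 else 0 := by
  have h1 : (deg K x : ℝ) ≠ 0 := by exact_mod_cast (hd x).ne'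
  simp only [lazyWalk, Matrix.of_apply, degW, (hd x).ne', if_false]
  split_ifs
  · ring
  · field_simp
  · ring

theorem lazyWalk_nonneg (x y : W) : 0 ≤ lazyWalk K x y := by
  simp only [lazyWalk, Matrix.of_apply]
  split_ifs <;> positivity

variable [Fintype W]

theorem deg_eq_sum (x : W) : (deg K x : ℝ) = ∑ y, if K.Adj x y then 1 else 0 := by
  rw [deg, Finset.sum_boole, ← Set.ncard_coe_finset]
  congr 2
  ext y
  simp

theorem sum_degW : ∑ x, degW K x = 2 * (K.edgeSet.ncard : ℝ) := by
  have h := K.sum_degrees_eq_twice_card_edges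
  have h1 : ∀ x, degW K x = (K.degree x : ℝ) := by
    intro x
    rw [degW, deg, ← SimpleGraph.card_neighborSet_eq_degree, ← Nat.card_coe_set_eq,
      Nat.card_eq_fintype_card]
  have h2 : K.edgeSet.ncard = K.edgeFinset.card := by
    rw [← Set.ncard_coe_finset]
    simp
  rw [h2]
  simp only [h1]
  exact_mod_cast h

theorem deg_pos (hK : K.Connected) [Nontrivial W] (x : W) : 0 < deg K x := by
  obtain ⟨y, hy⟩ := hK.preconnected.exists_adj_of_nontrivial x
  exact (Set.ncard_pos (Set.toFinite _)).2 ⟨y, hy⟩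

theorem wInner_degW {f g : W → ℝ} :
    wInner (degW K) f g = ∑ x, ∑ y, if K.Adj x y then f x * g x else 0 := by
  refine Finset.sum_congr rfl fun x _ => ?_
  rw [degW, deg_eq_sum, Finset.sum_mul]
  exact Finset.sum_congr rfl fun y _ => by split_ifs <;> ring

theorem wInner_degW' {f g : W → ℝ} :
    wInner (degW K) f g = ∑ x, ∑ y, if K.Adj x y then f y * g y else 0 := by
  rw [wInner_degW, Finset.sum_comm]
  simp only [K.adj_comm]

theorem wInner_lazyWalk (hd : ∀ x, 0 < deg K x) {f g : W → ℝ} :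
    wInner (degW K) (lazyWalk K *ᵥ f) g =
      wInner (degW K) f g / 2 + (∑ x, ∑ y, if K.Adj x y then f y * g x else 0) / 2 := by
  simp only [wInner, mulVec, dotProduct, Finset.sum_mul, Finset.mul_sum, Finset.sum_div,
    ← Finset.sum_add_distrib]
  refine Finset.sum_congr rfl fun x _ => ?_
  have h1 : ∀ y, degW K x * (lazyWalk K x y * f y * g x) =
      (if x = y then degW K x * (f x * g x) / 2 else 0) +
        (if K.Adj x y then f y * g x else 0) / 2 := by
    intro y
    rw [← mul_assoc, ← mul_assoc, degW_mul_lazyWalk hd]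
    by_cases h : x = y
    · subst h
      simp only [if_true, SimpleGraph.irrefl, if_false]
      ring
    · simp only [h, if_false]
      split_ifs <;> ring
  simp only [h1, Finset.sum_add_distrib, Finset.sum_ite_eq, Finset.mem_univ, if_true]

/-- The sum of the squared increments over all ordered pairs of neighbours. -/
def dirichlet (K : SimpleGraph W) (f : W → ℝ) : ℝ :=
  ∑ x, ∑ y, if K.Adj x y then (f x - f y) ^ 2 else 0

/-- One factor `1 / 2` comes from laziness, the other from `dirichlet` counting each edge in both
directions. -/
theorem dirichlet_eq (hd : ∀ x, 0 < deg K x) (f : W → ℝ) :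
    wInner (degW K) f f - wInner (degW K) (lazyWalk K *ᵥ f) f = dirichlet K f / 4 := by
  have h1 : dirichlet K f = 2 * wInner (degW K) f f -
      2 * ∑ x, ∑ y, if K.Adj x y then f y * f x else 0 := by
    rw [two_mul (wInner _ _ _)]
    nth_rw 2 [wInner_degW']
    rw [wInner_degW]
    simp only [dirichlet, Finset.mul_sum, ← Finset.sum_add_distrib, ← Finset.sum_sub_distrib]
    refine Finset.sum_congr rfl fun x _ => Finset.sum_congr rfl fun y _ => ?_
    split_ifs <;> ring
  rw [wInner_lazyWalk hd, h1]
  ring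

theorem isLazyReversible_lazyWalk (hd : ∀ x, 0 < deg K x) :
    IsLazyReversible (degW K) (lazyWalk K) where
  weight_nonneg x := Nat.cast_nonneg _
  reversible x y := by
    rw [degW_mul_lazyWalk hd, degW_mul_lazyWalk hd]
    by_cases h : x = y
    · rw [h]
    · simp only [h, Ne.symm h, if_false, K.adj_comm]
  nonneg f := by
    -- Laziness makes the form positive: it is a quarter of this sum of squares.
    have h1 : (0 : ℝ) ≤ ∑ x, ∑ y, if K.Adj x y then (f x + f y) ^ 2 else 0 :=
      Finset.sum_nonneg fun x _ => Finset.sum_nonneg fun y _ => by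
        split_ifs
        · positivity
        · exact le_rfl
    have h2 : (∑ x, ∑ y, if K.Adj x y then (f x + f y) ^ 2 else 0) =
        2 * wInner (degW K) f f + 2 * ∑ x, ∑ y, if K.Adj x y then f y * f x else 0 := by
      rw [two_mul (wInner _ _ _)]
      nth_rw 2 [wInner_degW']
      rw [wInner_degW]
      simp only [Finset.mul_sum, ← Finset.sum_add_distrib]
      refine Finset.sum_congr rfl fun x _ => Finset.sum_congr rfl fun y _ => ?_
      split_ifs <;> ring
    rw [wInner_lazyWalk hd]
    linarith
  le_self f := by
    rw [← sub_nonneg, dirichlet_eq hd]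
    refine div_nonneg (Finset.sum_nonneg fun x _ => Finset.sum_nonneg fun y _ => ?_) (by norm_num)
    split_ifs
    · positivity
    · exact le_rfl

theorem lazyWalk_mulVec_one (hd : ∀ x, 0 < deg K x) :
    lazyWalk K *ᵥ (fun _ => 1) = fun _ => 1 := by
  funext x
  have h1 : (deg K x : ℝ) ≠ 0 := by exact_mod_cast (hd x).ne'
  have h2 : ∀ y, lazyWalk K x y =
      (if x = y then 1 / 2 else 0) + 1 / (2 * (deg K x : ℝ)) * if K.Adj x y then 1 else 0 := by
    intro y
    simp only [lazyWalk, Matrix.of_apply, (hd x).ne', if_false]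
    by_cases h : x = y
    · subst h
      simp
    · simp [h]
  simp only [mulVec, dotProduct, mul_one, h2, Finset.sum_add_distrib, Finset.sum_ite_eq,
    Finset.mem_univ, if_true, ← Finset.mul_sum, ← deg_eq_sum]
  field_simp
  norm_num

theorem lazyWalk_pow_nonneg (t : ℕ) (x y : W) : 0 ≤ (lazyWalk K ^ t) x y := by
  induction t generalizing x y with
  | zero =>
    rw [pow_zero, Matrix.one_apply]
    split_ifs <;> norm_num
  | succ t ih =>
    rw [pow_succ, Matrix.mul_apply]
    exact Finset.sum_nonneg fun z _ => mul_nonneg (ih x z) (lazyWalk_nonneg z y)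

theorem lazyWalk_pow_mulVec_one (hd : ∀ x, 0 < deg K x) (t : ℕ) :
    lazyWalk K ^ t *ᵥ (fun _ => 1) = fun _ => 1 := by
  induction t with
  | zero => simp
  | succ t ih => rw [pow_succ, ← Matrix.mulVec_mulVec, lazyWalk_mulVec_one hd, ih]

theorem abs_sum_sub_le_tvDist (μ ν : W → ℝ) (A : Finset W) :
    |∑ x ∈ A, μ x - ∑ x ∈ A, ν x| ≤ tvDist μ ν :=
  le_ciSup (f := fun A : Finset W => |∑ x ∈ A, μ x - ∑ x ∈ A, ν x|)
    (Set.finite_range _).bddAbove A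

end LazyWalk

/-! ### Bounds on the mixing time of a connected graph -/

section MixingBounds
open Classical Matrix

variable {W : Type*} {K : SimpleGraph W}

/-- Along a walk, the squared increment is at most the length times the sum of the squared
increments of the steps. -/
theorem sq_sub_le_length_mul (h : W → ℝ) {u v : W} (q : K.Walk u v) :
    (h u - h v) ^ 2 ≤
      q.length * (q.darts.map fun e => (h e.fst - h e.snd) ^ 2).sum := by
  induction q with
  | nil => simp
  | @cons u w v huw q ih =>
    simp only [SimpleGraph.Walk.length_cons, SimpleGraph.Walk.darts_cons, List.map_cons,
      List.sum_cons]
    set S := (q.darts.map fun e => (h e.fst - h e.snd) ^ 2).sum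
    have hS : 0 ≤ S := List.sum_nonneg (by
      simp only [List.mem_map]
      rintro _ ⟨e, _, rfl⟩
      positivity)
    set l : ℝ := (q.length : ℝ) with hl
    have hl0 : 0 ≤ l := Nat.cast_nonneg _
    set a := h u - h w
    set b := h w - h v
    have hab : h u - h v = a + b := by simp [a, b]
    rw [hab]
    push_cast
    -- The induction hypothesis reads `b ^ 2 ≤ l * S`; this bounds the cross term by the
    -- arithmetic-geometric mean inequality.
    have h1 : 2 * (a * b) ≤ l * a ^ 2 + S := by
      refine le_of_abs_le (abs_le_of_sq_le_sq ?_ (by positivity))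
      have h2 : 4 * (a ^ 2 * b ^ 2) ≤ 4 * (a ^ 2 * (l * S)) := by gcongr
      nlinarith [sq_nonneg (l * a ^ 2 - S)]
    nlinarith

variable [Fintype W]

theorem sum_darts_le_dirichlet (h : W → ℝ) {u v : W} {q : K.Walk u v} (hq : q.IsPath) :
    (q.darts.map fun e => (h e.fst - h e.snd) ^ 2).sum ≤ dirichlet K h := by
  have h1 : q.darts.Nodup := SimpleGraph.Walk.darts_nodup_of_support_nodup hq.support_nodup
  rw [← List.sum_toFinset _ h1, dirichlet, ← Finset.sum_product', ← Finset.sum_filter]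
  rw [← Finset.sum_image (s := q.darts.toFinset) (g := fun e => e.toProd)
    (f := fun x : W × W => (h x.1 - h x.2) ^ 2)]
  · refine Finset.sum_le_sum_of_subset_of_nonneg ?_ fun _ _ _ => sq_nonneg _
    intro x hx
    obtain ⟨e, _, rfl⟩ := Finset.mem_image.1 hx
    simp
  · intro a _ b _ hab
    exact SimpleGraph.Dart.ext _ _ hab

/-- Effective resistance is at most graph distance: a shortest path uses each dart at most once, so
its squared increments are part of the Dirichlet sum. -/
theorem sq_sub_le_diam_mul_dirichlet (hK : K.Connected) (h : W → ℝ) (u v : W) :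
    (h u - h v) ^ 2 ≤ K.diam * dirichlet K h := by
  obtain ⟨q, hq, hl⟩ := hK.exists_path_of_dist u v
  have := hK.nonempty
  refine (sq_sub_le_length_mul h q).trans ?_
  refine mul_le_mul ?_ (sum_darts_le_dirichlet h hq) ?_ (Nat.cast_nonneg _)
  · rw [hl]
    exact_mod_cast SimpleGraph.dist_le_diam (SimpleGraph.connected_iff_ediam_ne_top.1 hK)
  · refine List.sum_nonneg ?_
    simp only [List.mem_map]
    rintro _ ⟨e, _, rfl⟩
    positivity

theorem edgeSet_ncard_pos (hK : K.Connected) [Nontrivial W] : 0 < K.edgeSet.ncard := by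
  obtain ⟨x⟩ := hK.nonempty
  obtain ⟨y, hy⟩ := hK.preconnected.exists_adj_of_nontrivial x
  exact (Set.ncard_pos (Set.toFinite _)).2 ⟨s(x, y), hy⟩

theorem stationary_eq (hK : K.Connected) [Nontrivial W] (x : W) :
    stationary K x = degW K x / ∑ y, degW K y := by
  have h : K.edgeSet ≠ ∅ := by
    rw [← Set.nonempty_iff_ne_empty, ← Set.ncard_pos (Set.toFinite _)]
    exact edgeSet_ncard_pos hK
  rw [stationary, if_neg h, sum_degW, degW]

/-- The lazy walk is mixed after `64 |E| diam` steps. -/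
theorem tvDist_lazyWalk_le (hK : K.Connected) [Nontrivial W] {t : ℕ}
    (ht : 64 * K.edgeSet.ncard * K.diam ≤ t) (x : W) :
    tvDist (fun y => (lazyWalk K ^ t) x y) (stationary K) ≤ 1 / 4 := by
  have hd := deg_pos hK
  have hP := isLazyReversible_lazyWalk hd
  set P := lazyWalk K with hPdef
  set d := degW K with hddef
  have hd0 : ∀ y, 0 < d y := fun y => Nat.cast_pos.2 (hd y)
  set m := ∑ y, d y with hm
  have hmE : m = 2 * (K.edgeSet.ncard : ℝ) := sum_degW
  have hE : 0 < (K.edgeSet.ncard : ℝ) := Nat.cast_pos.2 (edgeSet_ncard_pos hK)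
  have hm0 : 0 < m := by rw [hmE]; positivity
  -- The density of the point mass at `x` relative to `d`, centred to have mean zero.
  set f : W → ℝ := fun y => (if y = x then 1 / d x else 0) - 1 / m with hf
  have hfg : ∀ g : W → ℝ, wInner d f g = g x - (∑ y, d y * g y) / m := by
    intro g
    have : ∀ y, d y * (f y * g y) = (if y = x then g y else 0) - d y * g y / m := by
      intro y
      simp only [hf]
      split_ifs with h
      · subst h
        have := (hd0 y).ne'
        field_simp
      · ring
    simp only [wInner, this, Finset.sum_sub_distrib, Finset.sum_ite_eq', Finset.mem_univ, if_true,
      Finset.sum_div]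
  have hone : ∀ s : ℕ, ∑ y, d y * (P ^ s *ᵥ f) y = 0 := by
    intro s
    have h1 : wInner d (P ^ s *ᵥ f) (fun _ => 1) = wInner d f (fun _ => 1) := by
      rw [wInner_mulVec_comm (weight_mul_pow_comm hP.reversible s), lazyWalk_pow_mulVec_one hd]
    rw [hfg] at h1
    simp only [wInner, mul_one] at h1
    rw [h1, ← hm, div_self hm0.ne', sub_self]
  set a : ℕ → ℝ := fun s => wInner d (P ^ s *ᵥ f) f with ha
  have ha0 : ∀ s, 0 ≤ a s := fun s => hP.wInner_pow_nonneg s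
  have haanti : Antitone a := hP.wInner_pow_antitone
  -- the truncated Green function
  have green : ∀ T : ℕ, T * a T ≤ 4 * K.diam := by
    intro T
    set h : W → ℝ := ∑ s ∈ Finset.range T, P ^ s *ᵥ f with hh
    have hsum0 : ∑ y, d y * h y = 0 := by
      simp only [hh, Finset.sum_apply, Finset.mul_sum]
      rw [Finset.sum_comm]
      exact Finset.sum_eq_zero fun s _ => hone s
    have hx : h x = ∑ s ∈ Finset.range T, a s := by
      have := hfg h
      rw [hsum0, zero_div, sub_zero] at this
      rw [← this, hh, wInner_sum_right]
      exact Finset.sum_congr rfl fun s _ => wInner_comm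
    have hTa : T * a T ≤ h x := by
      rw [hx]
      have := Finset.card_nsmul_le_sum (Finset.range T) a (a T)
        fun s hs => haanti (Finset.mem_range.1 hs).le
      simpa using this
    have hx0 : 0 ≤ h x := by rw [hx]; exact Finset.sum_nonneg fun s _ => ha0 s
    have htel : h - P *ᵥ h = f - P ^ T *ᵥ f := by
      have h1 : ∀ n : ℕ, (∑ s ∈ Finset.range n, P ^ s *ᵥ f) -
          P *ᵥ (∑ s ∈ Finset.range n, P ^ s *ᵥ f) = f - P ^ n *ᵥ f := by
        intro n
        induction n with
        | zero => simp
        | succ n ih =>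
          rw [Finset.sum_range_succ, Matrix.mulVec_add, Matrix.mulVec_mulVec, ← pow_succ',
            add_sub_add_comm, ih]
          abel
      exact h1 T
    -- The sum telescopes to `h - P h = f - P ^ T f`. Pairing with `h` gives `h x` minus a sum of
    -- return weights, which is dropped.
    have henergy : dirichlet K h ≤ 4 * h x := by
      have h1 := dirichlet_eq hd h
      rw [← wInner_sub_left, htel, wInner_sub_left] at h1
      have h2 : 0 ≤ wInner d (P ^ T *ᵥ f) h := by
        rw [hh, wInner_sum_right]
        refine Finset.sum_nonneg fun s _ => ?_
        rw [← hP.wInner_pow_add]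
        exact ha0 _
      have h3 : wInner d f h = h x := by rw [hfg, hsum0, zero_div, sub_zero]
      rw [h3] at h1
      linarith
    -- As `h` has mean zero it is nonpositive somewhere, so `h x` is at most the increment from `y`
    -- to `x`, which the energy and the diameter control.
    obtain ⟨y, hy⟩ : ∃ y, h y ≤ 0 := by
      by_contra hcon
      push Not at hcon
      have : 0 < ∑ y, d y * h y :=
        Finset.sum_pos (fun y _ => mul_pos (hd0 y) (hcon y)) ⟨x, Finset.mem_univ x⟩
      linarith
    have h1 := sq_sub_le_diam_mul_dirichlet hK h x y
    have h2 : h x ^ 2 ≤ (h x - h y) ^ 2 := by gcongr; linarith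
    have h3 : (K.diam : ℝ) * dirichlet K h ≤ K.diam * (4 * h x) := by gcongr
    have h4 : h x * h x ≤ 4 * K.diam * h x := by nlinarith
    rcases hx0.eq_or_lt with h5 | h5
    · rw [← h5] at hTa
      exact hTa.trans (by positivity)
    · exact hTa.trans (le_of_mul_le_mul_right h4 h5)
  -- The target is `(1 / 4) ^ 2`, because Cauchy-Schwarz below bounds the squared discrepancy by `m
  -- * a (2 * t)`; this fixes the constant `64`.
  have hma : m * a (2 * t) ≤ 1 / 16 := by
    have h1 := green (2 * t)
    have h2 : 32 * m * K.diam ≤ t := by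
      rw [hmE]
      have : ((64 * K.edgeSet.ncard * K.diam : ℕ) : ℝ) ≤ t := by exact_mod_cast ht
      push_cast at this
      linarith
    have hD : 0 < (K.diam : ℝ) :=
      Nat.cast_pos.2 (Nat.pos_of_ne_zero (SimpleGraph.connected_iff_diam_ne_zero.1 hK))
    push_cast at h1
    have h3 : 2 * (32 * m * K.diam) * a (2 * t) ≤ 4 * K.diam := by
      refine le_trans ?_ h1
      have := ha0 (2 * t)
      gcongr
    have h4 : (16 * (m * a (2 * t))) * (4 * K.diam) ≤ 1 * (4 * K.diam) := by linarith
    have := le_of_mul_le_mul_right h4 (by positivity)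
    linarith
  refine ciSup_le fun A => ?_
  refine abs_le_of_sq_le_sq ?_ (by norm_num)
  have hPf : ∀ y, (P ^ t) x y - stationary K y = d y * (P ^ t *ᵥ f) y := by
    intro y
    have h1 : (P ^ t *ᵥ f) y = (P ^ t) y x / d x - 1 / m := by
      have h2 : (P ^ t *ᵥ fun _ => 1) y = 1 := congrFun (lazyWalk_pow_mulVec_one hd t) y
      simp only [mulVec, dotProduct, mul_one] at h2
      simp only [hf, mulVec, dotProduct, mul_sub, Finset.sum_sub_distrib, mul_ite, mul_zero,
        Finset.sum_ite_eq', Finset.mem_univ, if_true, ← Finset.sum_mul, h2, one_mul]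
      ring
    rw [h1, stationary_eq hK, mul_sub, mul_div_assoc',
      ← weight_mul_pow_comm hP.reversible t x y, mul_div_cancel_left₀ _ (hd0 x).ne']
    ring
  rw [← Finset.sum_sub_distrib]
  simp only [hPf]
  have hcs := Finset.sum_mul_sq_le_sq_mul_sq A (fun y => √(d y))
    (fun y => √(d y) * (P ^ t *ᵥ f) y)
  simp only [← mul_assoc, Real.mul_self_sqrt (hd0 _).le, mul_pow, Real.sq_sqrt (hd0 _).le] at hcs
  refine hcs.trans ?_
  have h1 : ∑ y ∈ A, d y ≤ m :=
    Finset.sum_le_sum_of_subset_of_nonneg (Finset.subset_univ A) fun y _ _ => (hd0 y).le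
  have h2 : ∑ y ∈ A, d y * (P ^ t *ᵥ f) y ^ 2 ≤ a (2 * t) := by
    simp only [ha]
    rw [two_mul, hP.wInner_pow_add, wInner]
    simp only [← pow_two]
    exact Finset.sum_le_sum_of_subset_of_nonneg (Finset.subset_univ A)
      fun y _ _ => mul_nonneg (hd0 y).le (sq_nonneg _)
  calc (∑ y ∈ A, d y) * ∑ y ∈ A, d y * (P ^ t *ᵥ f) y ^ 2 ≤ m * a (2 * t) :=
        mul_le_mul h1 h2 (Finset.sum_nonneg fun y _ => mul_nonneg (hd0 y).le (sq_nonneg _)) hm0.le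
    _ ≤ (1 / 4) ^ 2 := by linarith

theorem mixingTime_le (hK : K.Connected) [Nontrivial W] :
    mixingTime K ≤ 64 * K.edgeSet.ncard * K.diam :=
  Nat.sInf_le fun x => tvDist_lazyWalk_le hK le_rfl x

/-- The infimum defining `mixingTime` is attained only if the set of admissible times is nonempty,
which the upper bound provides. -/
theorem tvDist_mixingTime_le (hK : K.Connected) [Nontrivial W] (x : W) :
    tvDist (fun y => (lazyWalk K ^ mixingTime K) x y) (stationary K) ≤ 1 / 4 :=
  Nat.sInf_mem (s := {t : ℕ | ∀ x : W,
    tvDist (fun y => (lazyWalk K ^ t) x y) (stationary K) ≤ 1 / 4})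
    ⟨_, fun x => tvDist_lazyWalk_le hK le_rfl x⟩ x

theorem mixingTime_eq_zero [Subsingleton W] : mixingTime K = 0 := by
  refine Nat.le_zero.1 (Nat.sInf_le fun x => ciSup_le fun A => ?_)
  have hE : K.edgeSet = ∅ := by
    rw [SimpleGraph.edgeSet_eq_empty]
    exact Subsingleton.elim _ _
  have : ∀ y, (lazyWalk K ^ 0) x y = stationary K y := by
    intro y
    rw [Subsingleton.elim y x, pow_zero, Matrix.one_apply_eq, stationary, if_pos hE]
  simp only [this, sub_self, abs_zero]
  norm_num

/-- The mixing time is at least a constant times the inverse of the Rayleigh quotient of every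
function which is supported in a set of at most a quarter of the stationary mass. -/
theorem sum_degW_mul_sq_le_mixingTime_mul (hK : K.Connected) [Nontrivial W] {f : W → ℝ}
    {B : Set W} (hf : ∀ x, x ∉ B → f x = 0)
    (hB : ∑ x with x ∈ B, (deg K x : ℝ) ≤ K.edgeSet.ncard / 2) :
    ∑ x, (deg K x : ℝ) * f x ^ 2 ≤ mixingTime K / 2 * dirichlet K f := by
  have hd := deg_pos hK
  have hP := isLazyReversible_lazyWalk hd
  have hE : 0 < (K.edgeSet.ncard : ℝ) := Nat.cast_pos.2 (edgeSet_ncard_pos hK)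
  have h1 := hP.wInner_le_of_pow_le_half (f := f) (B := B) (t := mixingTime K)
    (lazyWalk_pow_nonneg _) hf fun x => ?_
  · rw [dirichlet_eq hd] at h1
    have h2 : wInner (degW K) f f = ∑ x, (deg K x : ℝ) * f x ^ 2 := by
      simp only [wInner, degW, pow_two]
    rw [h2] at h1
    linarith
  · have h2 := (abs_sum_sub_le_tvDist _ _ (Finset.univ.filter (· ∈ B))).trans
      (tvDist_mixingTime_le hK x)
    -- Stationary mass `1 / 4` plus total variation error `1 / 4` gives the required `1 / 2`.
    have h3 : ∑ y with y ∈ B, stationary K y ≤ 1 / 4 := by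
      simp only [stationary_eq hK, ← Finset.sum_div]
      rw [sum_degW, div_le_iff₀ (by positivity)]
      simp only [degW]
      linarith
    have := le_of_abs_le h2
    linarith

/-- The lazy walk on a graph with at least two vertices is not mixed at time zero. -/
theorem mixingTime_pos (hK : K.Connected) [Nontrivial W] : 0 < mixingTime K := by
  have hd := deg_pos hK
  by_contra h0
  have h0 : mixingTime K = 0 := by omega
  -- At time zero the walk is a point mass, so every single vertex would carry stationary mass at
  -- least `3 / 4`; two vertices already exceed `1`.
  have h1 : ∀ x, 3 / 4 ≤ stationary K x := by
    intro x
    have h2 := (abs_sum_sub_le_tvDist _ _ {x}).trans (tvDist_mixingTime_le hK x)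
    rw [h0] at h2
    simp only [pow_zero, Finset.sum_singleton, Matrix.one_apply_eq] at h2
    have := le_of_abs_le h2
    linarith
  obtain ⟨x, y, hxy⟩ := exists_pair_ne W
  have hm : 0 < ∑ z, degW K z := by
    rw [sum_degW]
    have : 0 < (K.edgeSet.ncard : ℝ) := Nat.cast_pos.2 (edgeSet_ncard_pos hK)
    positivity
  have h2 : stationary K x + stationary K y ≤ 1 := by
    rw [stationary_eq hK, stationary_eq hK, ← add_div, div_le_one hm, ← Finset.sum_pair hxy]
    exact Finset.sum_le_sum_of_subset_of_nonneg (Finset.subset_univ _)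
      fun z _ _ => Nat.cast_nonneg _
  linarith [h1 x, h1 y]

end MixingBounds

/-! ### Components as graphs of their own -/

section Components
open Classical

variable {V : Type*} {H : SimpleGraph V}

/-- The vertex set of the component of `v`. -/
def cluster (H : SimpleGraph V) (v : V) : Set V := {u | H.Reachable v u}

theorem supp_eq_cluster {C : H.ConnectedComponent} {v : V} (hv : v ∈ C.supp) :
    C.supp = cluster H v := by
  ext u
  rw [SimpleGraph.ConnectedComponent.mem_supp_iff] at hv ⊢
  rw [← hv, SimpleGraph.ConnectedComponent.eq]
  exact SimpleGraph.reachable_comm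

theorem exists_mem_supp (C : H.ConnectedComponent) : ∃ v, v ∈ C.supp := C.nonempty_supp

theorem cluster_subset_ball {v : V} {k : ℕ} (h : ¬ (sphere H v k).Nonempty) :
    cluster H v ⊆ ball H v k := by
  intro u hu
  refine ⟨hu, ?_⟩
  by_contra hk
  exact h (sphere_nonempty_of_le_dist hu (by omega))

theorem edgesIn_mono {S T : Set V} (h : S ⊆ T) : edgesIn H S ⊆ edgesIn H T :=
  fun _ he => ⟨he.1, fun x hx => h (he.2 x hx)⟩

/-- A walk that starts in a component never leaves it. -/
theorem dist_toSimpleGraph (C : H.ConnectedComponent) (x y : C) :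
    C.toSimpleGraph.dist x y = H.dist x y := by
  refine le_antisymm ?_ ?_
  · have hr : H.Reachable x y := C.reachable_of_mem_supp x.2 y.2
    obtain ⟨q, hq⟩ := hr.exists_walk_length_eq_dist
    have key : ∀ {u v : V} (q : H.Walk u v) (hu : u ∈ C) (hv : v ∈ C),
        ∃ q' : C.toSimpleGraph.Walk ⟨u, hu⟩ ⟨v, hv⟩, q'.length = q.length := by
      intro u v q
      induction q with
      | nil => exact fun hu hv => ⟨.nil, rfl⟩
      | @cons u w v h q ih =>
        intro hu hv
        have hw : w ∈ C := C.mem_supp_of_adj_mem_supp hu h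
        obtain ⟨q', hq'⟩ := ih hw hv
        have hadj : C.toSimpleGraph.Adj ⟨u, hu⟩ ⟨w, hw⟩ :=
          (C.toSimpleGraph_adj hu hw).2 h
        exact ⟨.cons hadj q', by simp [hq']⟩
    obtain ⟨q', hq'⟩ := key q x.2 y.2
    rw [← hq, ← hq']
    exact SimpleGraph.dist_le q'
  · obtain ⟨q, hq⟩ := (C.connected_toSimpleGraph.preconnected x y).exists_walk_length_eq_dist
    rw [← hq]
    have := SimpleGraph.dist_le (q.map C.toSimpleGraph_hom)
    rw [SimpleGraph.Walk.length_map] at this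
    exact this

/-- Each time a walk crosses the extra edge it restarts from `x` or from `y`. -/
theorem reachable_of_sup_edge {H₁ H₂ : SimpleGraph V} {x y u : V}
    (h₁ : H₁ ≤ SimpleGraph.fromEdgeSet {s(x, y)}) (hu : (H₁ ⊔ H₂).Reachable x u) :
    H₂.Reachable x u ∨ H₂.Reachable y u := by
  obtain ⟨q⟩ := hu
  have key : ∀ {a b : V} (q : (H₁ ⊔ H₂).Walk a b), H₂.Reachable x a ∨ H₂.Reachable y a →
      H₂.Reachable x b ∨ H₂.Reachable y b := by
    intro a b q
    induction q with
    | nil => exact id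
    | @cons a c b h q ih =>
      intro ha
      apply ih
      rcases (SimpleGraph.sup_adj ..).1 h with h | h
      · have := h₁ h
        simp only [SimpleGraph.fromEdgeSet_adj, Set.mem_singleton_iff, Sym2.eq_iff] at this
        rcases this.1 with ⟨-, rfl⟩ | ⟨-, rfl⟩
        · exact .inr .rfl
        · exact .inl .rfl
      · exact ha.imp (fun ha => ha.trans h.reachable) fun ha => ha.trans h.reachable
  exact key q (.inl .rfl)

theorem compEdges_eq (C : H.ConnectedComponent) :
    compEdges C = C.toSimpleGraph.edgeSet.ncard := by
  unfold compEdges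
  symm
  refine Set.ncard_congr (t := edgesIn H C.supp) (fun e _ => e.map Subtype.val) ?_ ?_ ?_
  · intro e he
    induction e with
    | _ x y =>
      refine ⟨(C.toSimpleGraph_adj x.2 y.2).1 he, ?_⟩
      intro z hz
      simp only [Sym2.map_mk, Sym2.mem_iff] at hz
      rcases hz with rfl | rfl
      · exact x.2
      · exact y.2
  · intro e e' _ _ h
    exact Sym2.map.injective Subtype.val_injective h
  · intro e he
    induction e with
    | _ x y =>
      have hx : x ∈ C := he.2 x (by simp)
      have hy : y ∈ C := he.2 y (by simp)
      exact ⟨s(⟨x, hx⟩, ⟨y, hy⟩), (C.toSimpleGraph_adj hx hy).2 he.1, rfl⟩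

theorem compCard_le (C : H.ConnectedComponent) : compCard C ≤ compEdges C + 1 := by
  rw [compEdges_eq]
  have := C.connected_toSimpleGraph.card_vert_le_card_edgeSet_add_one
  rw [Nat.card_coe_set_eq] at this
  exact this

/-- By the triangle inequality one end of a diametral pair is at distance at least half the diameter
from `v`. -/
theorem sphere_nonempty_of_two_mul_le {C : H.ConnectedComponent} {v : V} (hv : v ∈ C.supp)
    {k : ℕ} (hk : 2 * k ≤ compDiam C + 1) : (sphere H v k).Nonempty := by
  have := C.connected_toSimpleGraph.nonempty
  obtain ⟨x, y, hxy⟩ := C.toSimpleGraph.exists_dist_eq_diam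
  have h1 := C.connected_toSimpleGraph.dist_triangle (u := x) (v := ⟨v, hv⟩) (w := y)
  rw [hxy, SimpleGraph.dist_comm, dist_toSimpleGraph, dist_toSimpleGraph] at h1
  have hx : H.Reachable v x := C.reachable_of_mem_supp hv x.2
  have hy : H.Reachable v y := C.reachable_of_mem_supp hv y.2
  unfold compDiam at hk
  simp only at h1
  rcases le_or_gt k (H.dist v x) with h | h
  · exact sphere_nonempty_of_le_dist hx h
  · exact sphere_nonempty_of_le_dist hy (by omega)

variable [Fintype V]


theorem nontrivial_of_one_lt_compCard {C : H.ConnectedComponent} (h : 1 < compCard C) :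
    Nontrivial C := by
  obtain ⟨a, b, ha, hb, hab⟩ := (Set.one_lt_ncard_iff (Set.toFinite _)).1 h
  exact ⟨⟨a, ha⟩, ⟨b, hb⟩, fun h => hab (congrArg Subtype.val h)⟩

theorem cluster_subset_ball_of_compDiam_le {C : H.ConnectedComponent} {v : V}
    (hv : v ∈ C.supp) {k : ℕ} (hk : compDiam C ≤ k) : cluster H v ⊆ ball H v k := by
  intro u hu
  have huC : u ∈ C.supp := by rw [supp_eq_cluster hv]; exact hu
  refine ⟨hu, le_trans ?_ hk⟩
  have := C.connected_toSimpleGraph.nonempty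
  have h1 := SimpleGraph.dist_le_diam
    (SimpleGraph.connected_iff_ediam_ne_top.1 C.connected_toSimpleGraph)
    (u := ⟨v, hv⟩) (v := ⟨u, huC⟩)
  rwa [dist_toSimpleGraph] at h1

theorem compDiam_pos {C : H.ConnectedComponent} (h : 1 < compCard C) : 0 < compDiam C := by
  have := nontrivial_of_one_lt_compCard h
  exact Nat.pos_of_ne_zero (SimpleGraph.connected_iff_diam_ne_zero.1 C.connected_toSimpleGraph)

theorem compMix_le (C : H.ConnectedComponent) : compMix C ≤ 64 * compEdges C * compDiam C := by
  unfold compMix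
  rcases subsingleton_or_nontrivial C with h | h
  · exact mixingTime_eq_zero.trans_le (Nat.zero_le _)
  · rw [compEdges_eq]
    exact mixingTime_le C.connected_toSimpleGraph

theorem compMix_pos {C : H.ConnectedComponent} (h : 1 < compCard C) : 0 < compMix C := by
  have := nontrivial_of_one_lt_compCard h
  exact mixingTime_pos C.connected_toSimpleGraph

end Components

/-! ### First moment bounds for diameters and edge counts -/

section DiameterAndEdges
open Classical

variable {V : Type*} [Fintype V] {G : SimpleGraph V} {p : unitInterval}

/-- A large component all of whose vertices are bad is unlikely if each vertex is unlikely to be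
bad. -/
theorem percProb_exists_component_le {Bad : SimpleGraph V → V → Prop} {δ M : ℝ} (hM : 0 < M)
    (h : ∀ v, percProb G p {H | Bad H v} ≤ δ) :
    percProb G p {H | ∃ C : H.ConnectedComponent, M < compCard C ∧ ∀ v ∈ C.supp, Bad H v} ≤
      Fintype.card V * δ / M := by
  -- Markov's inequality for the number of bad vertices.
  refine (percProb_le_div (f := fun H => ∑ v, if H ∈ {H | Bad H v} then 1 else 0) hM
    (fun H _ => Finset.sum_nonneg fun v _ => by split_ifs <;> norm_num) ?_).trans ?_
  · rintro H _ ⟨C, hC, hb⟩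
    refine hC.le.trans ?_
    rw [Finset.sum_boole, compCard]
    refine Nat.cast_le.2 ?_
    rw [← Set.ncard_coe_finset]
    exact Set.ncard_le_ncard (fun v hv =>
      Finset.mem_coe.2 (Finset.mem_filter.2 ⟨Finset.mem_univ v, hb v hv⟩)) (Set.toFinite _)
  · refine div_le_div_of_nonneg_right ?_ hM.le
    rw [percExp_sum]
    simp only [← percProb_eq_percExp]
    refine (Finset.sum_le_sum fun v _ => h v).trans ?_
    simp

/-- In every subgraph, balls have linearly many edges on average, and the cluster of a vertex
reaches distance `k` with probability of order at most `1 / k`. -/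
def CriticalBounds (G : SimpleGraph V) (p : unitInterval) (c₁ c₂ : ℝ) : Prop :=
  ∀ G' : SimpleGraph V, G' ≤ G → ∀ (v : V) (k : ℕ), 1 ≤ k →
    percExp G' p (fun H => ((edgesIn H (ball H v k)).ncard : ℝ)) ≤ c₁ * k ∧
    percProb G' p {H | (sphere H v k).Nonempty} ≤ c₂ / k

variable {c₁ c₂ : ℝ}

theorem CriticalBounds.percProb_edges_le (hG : CriticalBounds G p c₁ c₂) {G' : SimpleGraph V}
    (hG' : G' ≤ G) (v : V) {k : ℕ} (hk : 1 ≤ k) {m : ℝ} (hm : 0 < m) :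
    percProb G' p {H | m ≤ (edgesIn H (ball H v k)).ncard} ≤ c₁ * k / m :=
  (percProb_le_div hm (fun _ _ => Nat.cast_nonneg _) fun _ _ h => h).trans
    (div_le_div_of_nonneg_right (hG G' hG' v k hk).1 hm.le)

/-- Either the cluster survives to distance `k` or it is contained in the ball of radius `k`; the
radius is left free to be optimised. -/
theorem CriticalBounds.percProb_cluster_le (hG : CriticalBounds G p c₁ c₂) {G' : SimpleGraph V}
    (hG' : G' ≤ G) (v : V) {k : ℕ} (hk : 1 ≤ k) {m : ℝ} (hm : 0 < m) :
    percProb G' p {H | m ≤ (edgesIn H (cluster H v)).ncard} ≤ c₂ / k + c₁ * k / m := by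
  refine (percProb_le_add (T := {H | (sphere H v k).Nonempty})
    (U := {H | m ≤ (edgesIn H (ball H v k)).ncard}) ?_).trans
    (add_le_add (hG G' hG' v k hk).2 (hG.percProb_edges_le hG' v hk hm))
  intro H _ hH
  by_cases hs : (sphere H v k).Nonempty
  · exact .inl hs
  · refine .inr (le_trans (b := ((edgesIn H (cluster H v)).ncard : ℝ)) hH ?_)
    exact_mod_cast Set.ncard_le_ncard (edgesIn_mono (cluster_subset_ball hs)) (Set.toFinite _)

theorem CriticalBounds.percProb_diam_gt_le (hG : CriticalBounds G p c₁ c₂) (hc₂ : 0 < c₂)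
    {M R : ℝ} (hM : 0 < M) (hR : 0 < R) :
    percProb G p {H | ∃ C : H.ConnectedComponent, M < compCard C ∧ R < compDiam C} ≤
      Fintype.card V * (2 * c₂ / R) / M := by
  -- Rounding gives `2 k < R + 2`, hence `2 k ≤ diam + 1` when `R < diam`.
  set k := ⌈R / 2⌉₊ with hk
  have hk0 : 1 ≤ k := Nat.one_le_iff_ne_zero.2 (Nat.ceil_pos.2 (by positivity)).ne'
  refine (percProb_mono ?_).trans (percProb_exists_component_le
    (Bad := fun H v => (sphere H v k).Nonempty) (δ := 2 * c₂ / R) hM fun v => ?_)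
  · rintro H _ ⟨C, hC, hR'⟩
    refine ⟨C, hC, fun v hv => sphere_nonempty_of_two_mul_le hv ?_⟩
    have h1 : (k : ℝ) < R / 2 + 1 := Nat.ceil_lt_add_one (by positivity)
    have h2 : ((2 * k : ℕ) : ℝ) < (compDiam C + 2 : ℕ) := by push_cast; linarith
    have := Nat.cast_lt.1 h2
    omega
  · refine (hG G le_rfl v k hk0).2.trans ?_
    have h1 : R / 2 ≤ k := Nat.le_ceil _
    rw [show 2 * c₂ / R = c₂ / (R / 2) by field_simp]
    gcongr

theorem CriticalBounds.percProb_diam_lt_le (hG : CriticalBounds G p c₁ c₂) (hc₁ : 0 < c₁)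
    {M R : ℝ} (hM : 1 ≤ M) (hR : 0 < R) :
    percProb G p {H | ∃ C : H.ConnectedComponent, M < compCard C ∧ compDiam C < R} ≤
      Fintype.card V * (4 * c₁ * R / M) / M := by
  have hM0 : 0 < M := by linarith
  have hcard : ∀ {H : SimpleGraph V} {C : H.ConnectedComponent}, M < compCard C →
      1 < compCard C := by
    intro H C h
    exact_mod_cast hM.trans_lt h
  -- Components with more than one vertex have diameter at least `1`, so only `R > 1` matters, where
  -- rounding up at most doubles `R`.
  rcases le_or_gt R 1 with hR1 | hR1
  · rw [percProb_eq_zero]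
    · positivity
    · rintro H _ ⟨C, hC, hd⟩
      have h1 : (1 : ℝ) ≤ compDiam C := by exact_mod_cast compDiam_pos (hcard hC)
      linarith
  set k := ⌈R⌉₊ with hk
  have hk0 : 1 ≤ k := Nat.one_le_iff_ne_zero.2 (Nat.ceil_pos.2 (by positivity)).ne'
  refine (percProb_mono ?_).trans (percProb_exists_component_le
    (Bad := fun H v => M / 2 ≤ (edgesIn H (ball H v k)).ncard) (δ := 4 * c₁ * R / M) hM0
      fun v => ?_)
  · rintro H _ ⟨C, hC, hd⟩
    refine ⟨C, hC, fun v hv => ?_⟩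
    have hdk : compDiam C ≤ k := by
      have := hd.trans_le (Nat.le_ceil R)
      exact (Nat.cast_lt.1 this).le
    have h1 : compEdges C ≤ (edgesIn H (ball H v k)).ncard := by
      rw [compEdges, supp_eq_cluster hv]
      exact Set.ncard_le_ncard (edgesIn_mono (cluster_subset_ball_of_compDiam_le hv hdk))
        (Set.toFinite _)
    have h2 := compCard_le C
    have h3 := hcard hC
    have h4 : compCard C ≤ 2 * (edgesIn H (ball H v k)).ncard := by omega
    have h5 : (compCard C : ℝ) ≤ 2 * (edgesIn H (ball H v k)).ncard := by exact_mod_cast h4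
    linarith
  · refine (hG.percProb_edges_le le_rfl v hk0 (by positivity)).trans ?_
    have h1 : (k : ℝ) < R + 1 := Nat.ceil_lt_add_one (by positivity)
    rw [div_div_eq_mul_div]
    refine div_le_div_of_nonneg_right ?_ hM0.le
    nlinarith

theorem ncard_edgesIn_sup_le {H₁ H₂ : SimpleGraph V} {x y : V}
    (h₁ : H₁ ≤ SimpleGraph.fromEdgeSet {s(x, y)}) :
    (edgesIn (H₁ ⊔ H₂) (cluster (H₁ ⊔ H₂) x)).ncard ≤
      1 + ((edgesIn H₂ (cluster H₂ x)).ncard + (edgesIn H₂ (cluster H₂ y)).ncard) := by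
  have hsub : edgesIn (H₁ ⊔ H₂) (cluster (H₁ ⊔ H₂) x) ⊆
      {s(x, y)} ∪ (edgesIn H₂ (cluster H₂ x) ∪ edgesIn H₂ (cluster H₂ y)) := by
    intro e he
    induction e with
    | _ a b =>
      obtain ⟨hab, hx⟩ := he
      have ha := reachable_of_sup_edge h₁ (hx a (by simp))
      rcases (SimpleGraph.sup_adj ..).1 hab with h | h
      · left
        have := h₁ h
        simp only [SimpleGraph.fromEdgeSet_adj] at this
        exact this.1
      · right
        refine ha.imp (fun ha => ⟨h, ?_⟩) (fun ha => ⟨h, ?_⟩) <;>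
        · intro z hz
          rcases Sym2.mem_iff.1 hz with rfl | rfl
          · exact ha
          · exact ha.trans h.reachable
  refine (Set.ncard_le_ncard hsub (Set.toFinite _)).trans ((Set.ncard_union_le _ _).trans ?_)
  rw [Set.ncard_singleton]
  exact Nat.add_le_add_left (Set.ncard_union_le _ _) 1

/-- The state of `xy` is independent of the other edges. If `xy` is retained in a cluster with more
than `M` edges, then without it the cluster of `x` or of `y` still has at least `(M - 1) / 2` edges,
and the hypotheses apply to `G` minus this edge. -/
theorem CriticalBounds.percExp_adj_big_le (hG : CriticalBounds G p c₁ c₂) {k : ℕ}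
    (hk : 1 ≤ k) {M : ℝ} (hM : 1 < M) (x y : V) :
    percExp G p (fun H => if H.Adj x y ∧ M < (edgesIn H (cluster H x)).ncard then 1 else 0) ≤
      percExp G p (fun H => if H.Adj x y then 1 else 0) *
        (2 * (c₂ / k + c₁ * k / ((M - 1) / 2))) := by
  by_cases hxy : G.Adj x y
  swap
  · have h1 : ∀ H ≤ G, ¬ H.Adj x y := fun H hH h => hxy (hH h)
    rw [percExp_congr (g := fun _ => 0) fun H hH => by simp [h1 H hH],
      percExp_congr (f := fun H => if H.Adj x y then (1 : ℝ) else 0) (g := fun _ => 0)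
        fun H hH => by simp [h1 H hH], percExp_const]
    simp
  set G₁ : SimpleGraph V := SimpleGraph.fromEdgeSet {s(x, y)} with hG₁
  set G₂ : SimpleGraph V := G \ G₁ with hG₂
  have hle : G₁ ≤ G := by
    intro a b hab
    simp only [hG₁, SimpleGraph.fromEdgeSet_adj, Set.mem_singleton_iff] at hab
    rw [← SimpleGraph.mem_edgeSet, hab.1]
    exact hxy
  have hd : Disjoint G₁ G₂ := disjoint_sdiff_self_right
  have hsup : G₁ ⊔ G₂ = G := sup_sdiff_cancel_right hle
  have hnot : ∀ H₂ ≤ G₂, ¬ H₂.Adj x y := by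
    intro H₂ h₂ h
    have := h₂ h
    rw [hG₂, SimpleGraph.sdiff_adj] at this
    exact this.2 (by simp [hG₁, hxy.ne])
  set m : ℝ := (M - 1) / 2 with hm
  have hm0 : 0 < m := by rw [hm]; linarith
  conv_lhs => rw [← hsup]
  conv_rhs => rw [← hsup]
  rw [percExp_sup hd, percExp_sup hd, ← percExp_mul_const]
  refine percExp_mono fun H₁ h₁ => ?_
  by_cases h1 : H₁.Adj x y
  swap
  · rw [percExp_congr (g := fun _ => 0) fun H₂ h₂ => by simp [h1, hnot H₂ h₂], percExp_const]
    refine (mul_eq_zero_of_left ?_ _).ge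
    refine (percExp_congr (g := fun _ => 0) fun H₂ h₂ => if_neg ?_).trans (percExp_const 0)
    simp [h1, hnot H₂ h₂]
  have h2 : ∀ H₂, (H₁ ⊔ H₂).Adj x y := fun H₂ => .inl h1
  simp only [h2, true_and, if_true, percExp_const, one_mul]
  have h3 : ∀ z, percProb G₂ p {H | m ≤ (edgesIn H (cluster H z)).ncard} ≤
      c₂ / k + c₁ * k / m := fun z => hG.percProb_cluster_le sdiff_le z hk hm0
  have h4 := percProb_le_add (G := G₂) (p := p)
    (S := {H₂ | M < (edgesIn (H₁ ⊔ H₂) (cluster (H₁ ⊔ H₂) x)).ncard})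
    (T := {H | m ≤ (edgesIn H (cluster H x)).ncard})
    (U := {H | m ≤ (edgesIn H (cluster H y)).ncard}) ?_
  · rw [percProb_eq_percExp] at h4
    refine h4.trans ?_
    linarith [h3 x, h3 y]
  · intro H₂ _ hH
    by_contra hcon
    simp only [Set.mem_ofPred_eq, not_or, not_le] at hcon hH
    have h5 := ncard_edgesIn_sup_le (H₂ := H₂) h₁
    have h6 : ((edgesIn (H₁ ⊔ H₂) (cluster (H₁ ⊔ H₂) x)).ncard : ℝ) ≤
      1 + ((edgesIn H₂ (cluster H₂ x)).ncard + (edgesIn H₂ (cluster H₂ y)).ncard) := by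
      exact_mod_cast h5
    have h7 : M = 1 + 2 * m := by rw [hm]; ring
    linarith [hcon.1, hcon.2]

/-- With the edge bound at radius `1`, this shows that expected degrees are at most `c₁`. -/
theorem sum_adj_le_ncard (H : SimpleGraph V) (x : V) :
    (∑ y, if H.Adj x y then (1 : ℝ) else 0) ≤ (edgesIn H (ball H x 1)).ncard := by
  rw [Finset.sum_boole]
  refine Nat.cast_le.2 ?_
  rw [← Set.ncard_coe_finset]
  refine Set.ncard_le_ncard_of_injOn (t := edgesIn H (ball H x 1)) (fun y => s(x, y)) ?_ ?_ (Set.toFinite _)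
  · intro y hy
    have hy : H.Adj x y := by simpa using hy
    refine ⟨hy, fun z hz => ?_⟩
    rcases Sym2.mem_iff.1 hz with rfl | rfl
    · exact self_mem_ball
    · exact mem_ball_of_adj (k := 0) self_mem_ball hy
  · exact fun a _ b _ h => Sym2.congr_right.1 h

/-- Markov's inequality for the number of ordered adjacent pairs in oversized clusters, of which an
oversized component supplies more than `M`. -/
theorem CriticalBounds.percProb_edges_gt_le (hG : CriticalBounds G p c₁ c₂) (hc₁ : 0 < c₁)
    (hc₂ : 0 < c₂) {M : ℝ} (hM : 2 ≤ M) :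
    percProb G p {H | ∃ C : H.ConnectedComponent, M < compEdges C} ≤
      Fintype.card V * (2 * c₁ * (c₂ + 8 * c₁)) / (√M * M) := by
  have hM0 : 0 < M := by linarith
  -- This radius balances the survival term `c₂ / k` against the volume term of order `c₁ k / M`.
  set k := ⌈√M⌉₊ with hk
  have hs1 : 1 ≤ √M := Real.one_le_sqrt.2 (by linarith)
  have hk0 : 1 ≤ k := Nat.one_le_iff_ne_zero.2 (Nat.ceil_pos.2 (by positivity)).ne'
  have hk1 : √M ≤ k := Nat.le_ceil _
  have hk2 : (k : ℝ) ≤ 2 * √M := by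
    have : (k : ℝ) < √M + 1 := Nat.ceil_lt_add_one (by positivity)
    linarith
  have hQ : c₂ / k + c₁ * k / ((M - 1) / 2) ≤ (c₂ + 8 * c₁) / √M := by
    have h1 : c₂ / k ≤ c₂ / √M := by gcongr
    have h2 : c₁ * k / ((M - 1) / 2) ≤ c₁ * (2 * √M) / (M / 4) := by
      exact div_le_div₀ (by positivity) (by gcongr) (by positivity) (by linarith)
    have h3 : c₁ * (2 * √M) / (M / 4) = 8 * c₁ / √M := by
      have := Real.mul_self_sqrt hM0.le
      rw [div_eq_div_iff (by positivity) (by positivity)]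
      linear_combination 2 * c₁ * this
    rw [add_div]
    linarith
  set F : SimpleGraph V → ℝ := fun H => ∑ x, ∑ y,
    if H.Adj x y ∧ M < (edgesIn H (cluster H x)).ncard then 1 else 0 with hF
  refine (percProb_le_div (f := F) hM0 (fun H _ => Finset.sum_nonneg fun x _ =>
    Finset.sum_nonneg fun y _ => by split_ifs <;> norm_num) ?_).trans ?_
  · rintro H _ ⟨C, hC⟩
    refine hC.le.trans ?_
    rw [hF]
    simp only
    rw [← Finset.sum_product', Finset.sum_boole]
    refine Nat.cast_le.2 ?_
    rw [compEdges, ← Set.ncard_coe_finset]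
    refine (Set.ncard_le_ncard ?_ (Set.toFinite _)).trans
      (Set.ncard_image_le (f := fun z : V × V => s(z.1, z.2)) (Set.toFinite _))
    intro e he
    induction e with
    | _ a b =>
      refine ⟨(a, b), ?_, rfl⟩
      have ha : a ∈ C.supp := he.2 a (by simp)
      rw [compEdges, supp_eq_cluster ha] at hC
      simpa using ⟨he.1, hC⟩
  · have hadj : ∑ x : V, ∑ y : V, percExp G p (fun H => if H.Adj x y then 1 else 0) ≤
        Fintype.card V * c₁ := by
      have h1 : ∀ x : V, ∑ y : V, percExp G p (fun H => if H.Adj x y then 1 else 0) ≤ c₁ := by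
        intro x
        rw [← percExp_sum]
        refine (percExp_mono fun H _ => sum_adj_le_ncard H x).trans ?_
        simpa using (hG G le_rfl x 1 le_rfl).1
      refine (Finset.sum_le_sum fun x _ => h1 x).trans ?_
      simp
    have hFle : percExp G p F ≤ Fintype.card V * c₁ * (2 * ((c₂ + 8 * c₁) / √M)) := by
      rw [hF, percExp_sum]
      simp only [percExp_sum]
      refine (Finset.sum_le_sum fun x _ => Finset.sum_le_sum fun y _ =>
        hG.percExp_adj_big_le hk0 (by linarith) x y).trans ?_
      simp only [← Finset.sum_mul]
      refine mul_le_mul hadj ?_ ?_ ?_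
      · linarith
      · have : 0 < M - 1 := by linarith
        positivity
      · positivity
    refine (div_le_div_of_nonneg_right hFle hM0.le).trans (le_of_eq ?_)
    field_simp

end DiameterAndEdges

/-! ### Lanes and the test function for the mixing time -/

section Lanes
open Classical

variable {V : Type*} {H K : SimpleGraph V} {v x y z : V} {i q : ℕ}

theorem ball_trans {a b : ℕ} (hK : K ≤ H) (hy : y ∈ ball H v a) (hz : z ∈ ball K y b) :
    z ∈ ball H v (a + b) := by
  obtain ⟨w, hw⟩ := mem_ball_iff_exists_walk.1 hy
  obtain ⟨w', hw'⟩ := mem_ball_iff_exists_walk.1 (ball_mono_graph hK hz)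
  refine mem_ball_iff_exists_walk.2 ⟨w.append w', ?_⟩
  rw [SimpleGraph.Walk.length_append]
  omega

theorem sphere_nonempty_of_reachable {a b s : ℕ} (hK : K ≤ H) (hy : y ∈ ball H v a)
    (hr : K.Reachable y z) (hz : z ∉ ball H v b) (hab : a + s ≤ b + 1) :
    (sphere K y s).Nonempty := by
  refine sphere_nonempty_of_le_dist hr ?_
  by_contra hlt
  exact hz (ball_mono_radius (by omega) (ball_trans hK hy ⟨hr, le_rfl⟩))

/-- Every vertex outside the ball of radius `i` is reached from the sphere of radius `i + 1`
without entering that ball. -/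
theorem exists_sphere_reachable (hz : H.Reachable v z) (hzi : z ∉ ball H v i) :
    ∃ y ∈ sphere H v (i + 1), (avoiding H (ball H v i)).Reachable y z := by
  obtain ⟨m, hm⟩ : ∃ m, m = H.dist v z := ⟨_, rfl⟩
  induction m generalizing z with
  | zero => exact absurd ⟨hz, by omega⟩ hzi
  | succ m ih =>
    have hi : i < H.dist v z := by
      by_contra h
      exact hzi ⟨hz, by omega⟩
    rcases (show i + 1 ≤ H.dist v z by omega).eq_or_lt with h | h
    · exact ⟨z, ⟨hz, h.symm⟩, .rfl⟩
    · have h1 : z ∈ ball H v (m + 1) := ⟨hz, hm.ge⟩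
      rcases mem_ball_succ.1 h1 with h2 | ⟨w, hw, hwz⟩
      · exact absurd h2.2 (by omega)
      · have h3 := dist_le_succ_of_adj hw.1 hwz
        have h4 := hw.2
        have hwi : w ∉ ball H v i := fun h5 => by
          have := h5.2
          omega
        obtain ⟨y, hy, hyw⟩ := ih hw.1 hwi (by omega)
        exact ⟨y, hy, hyw.trans (SimpleGraph.Adj.reachable ⟨hwz, hwi, hzi⟩)⟩

/-- `y` lies outside the ball of radius `i` and is connected to the outside of the ball of radius
`r` without entering the ball of radius `i`. -/
def Escapes (H : SimpleGraph V) (v : V) (r i : ℕ) (y : V) : Prop :=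
  y ∉ ball H v i ∧ ∃ z, (avoiding H (ball H v i)).Reachable y z ∧ z ∉ ball H v r

/-- Outside the ball, `x` could step to `y` and follow its escape route. Hence an edge separated at
level `i` crosses from the ball to the next sphere. -/
theorem Escapes.mem_ball_of_not {r : ℕ} (hxy : H.Adj x y) (hy : Escapes H v r i y)
    (hx : ¬ Escapes H v r i x) : x ∈ ball H v i := by
  by_contra hxi
  obtain ⟨hyi, z, hz, hzr⟩ := hy
  exact hx ⟨hxi, z, (SimpleGraph.Adj.reachable (G := avoiding H (ball H v i))
    ⟨hxy, hxi, hyi⟩).trans hz, hzr⟩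

theorem Escapes.mem_sphere_of_not {r : ℕ} (hxy : H.Adj x y) (hy : Escapes H v r i y)
    (hx : ¬ Escapes H v r i x) : y ∈ sphere H v (i + 1) :=
  mem_sphere_succ.2 ⟨mem_ball_of_adj (hy.mem_ball_of_not hxy hx) hxy, hy.1⟩

theorem Escapes.sphere_nonempty {r s : ℕ} (hy : Escapes H v r i y)
    (hyi : y ∈ ball H v (i + 1)) (hr : i + s ≤ r) :
    (sphere (avoiding H (ball H v i)) y s).Nonempty := by
  obtain ⟨-, z, hz, hzr⟩ := hy
  exact sphere_nonempty_of_reachable (avoiding_le _ _) hyi hz hzr (by omega)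

/-- The proportion of the levels `2 q ≤ i < 3 q` at which `y` does not escape. -/
def laneFun (H : SimpleGraph V) (v : V) (q : ℕ) (y : V) : ℝ :=
  (∑ i ∈ Finset.Ico (2 * q) (3 * q), if Escapes H v (4 * q) i y then 0 else 1) / q

theorem laneFun_eq_one (hq : 0 < q) (hy : y ∈ ball H v (2 * q)) : laneFun H v q y = 1 := by
  have h1 : ∀ i ∈ Finset.Ico (2 * q) (3 * q),
      (if Escapes H v (4 * q) i y then (0 : ℝ) else 1) = 1 := by
    intro i hi
    rw [if_neg]
    exact fun h => h.1 (ball_mono_radius (Finset.mem_Ico.1 hi).1 hy)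
  rw [laneFun, Finset.sum_congr rfl h1, Finset.sum_const, Nat.card_Ico,
    show 3 * q - 2 * q = q by omega, nsmul_one, div_self (by exact_mod_cast hq.ne')]

theorem laneFun_eq_zero (hy : y ∉ ball H v (4 * q)) : laneFun H v q y = 0 := by
  have h1 : ∀ i ∈ Finset.Ico (2 * q) (3 * q),
      (if Escapes H v (4 * q) i y then (0 : ℝ) else 1) = 0 := by
    intro i hi
    have := (Finset.mem_Ico.1 hi).2
    exact if_pos ⟨fun h => hy (ball_mono_radius (by omega) h), y, .rfl, hy⟩
  rw [laneFun, Finset.sum_congr rfl h1, Finset.sum_const_zero, zero_div]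

theorem sq_sum_eq_of_pairwise {ι : Type*} (s : Finset ι) (a : ι → ℝ)
    (h : ∀ i ∈ s, ∀ j ∈ s, i ≠ j → a i * a j = 0) : (∑ i ∈ s, a i) ^ 2 = ∑ i ∈ s, a i ^ 2 := by
  rw [pow_two, Finset.sum_mul_sum]
  refine Finset.sum_congr rfl fun i hi => ?_
  rw [Finset.sum_eq_single_of_mem i hi fun j hj hji => h i hi j hj hji.symm, pow_two]

/-- The squared increment of the lane function along an edge counts the levels at which exactly
one end of the edge escapes. -/
theorem sq_laneFun_sub (hxy : H.Adj x y) :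
    (laneFun H v q x - laneFun H v q y) ^ 2 =
      (∑ i ∈ Finset.Ico (2 * q) (3 * q),
        ((if Escapes H v (4 * q) i y ∧ ¬ Escapes H v (4 * q) i x then 1 else 0) +
          if Escapes H v (4 * q) i x ∧ ¬ Escapes H v (4 * q) i y then 1 else 0)) / q ^ 2 := by
  rw [laneFun, laneFun, ← sub_div, div_pow, ← Finset.sum_sub_distrib, sq_sum_eq_of_pairwise]
  · congr 1
    refine Finset.sum_congr rfl fun i _ => ?_
    by_cases h1 : Escapes H v (4 * q) i x <;> by_cases h2 : Escapes H v (4 * q) i y <;>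
      simp [h1, h2]
  -- An edge is separated at one level at most: if at level `i`, both ends lie in the ball of radius
  -- `i + 1`, so neither escapes at a higher level.
  · have key : ∀ i j, i < j → Escapes H v (4 * q) i x ∧ ¬ Escapes H v (4 * q) i y ∨
        Escapes H v (4 * q) i y ∧ ¬ Escapes H v (4 * q) i x →
        ¬ Escapes H v (4 * q) j x ∧ ¬ Escapes H v (4 * q) j y := by
      rintro i j hij (⟨h1, h2⟩ | ⟨h1, h2⟩)
      · have hy := h1.mem_ball_of_not hxy.symm h2
        have hx := mem_ball_of_adj hy hxy.symm
        exact ⟨fun h => h.1 (ball_mono_radius hij hx), fun h => h.1 (ball_mono_radius hij.le hy)⟩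
      · have hx := h1.mem_ball_of_not hxy h2
        have hy := mem_ball_of_adj hx hxy
        exact ⟨fun h => h.1 (ball_mono_radius hij.le hx), fun h => h.1 (ball_mono_radius hij hy)⟩
    intro i _ j _ hij
    rcases lt_or_gt_of_ne hij with h | h
    · have := key i j h
      by_cases h1 : Escapes H v (4 * q) i x <;> by_cases h2 : Escapes H v (4 * q) i y <;>
        simp_all
    · have := key j i h
      by_cases h1 : Escapes H v (4 * q) j x <;> by_cases h2 : Escapes H v (4 * q) j y <;>
        simp_all

variable [Fintype V]

/-- The number of edges from the ball of radius `i` to the vertex `y` of the next sphere. -/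
def upEdges (v : V) (i : ℕ) (H : SimpleGraph V) (y : V) : ℝ :=
  ∑ x, if x ∈ ball H v i ∧ y ∈ sphere H v (i + 1) ∧ H.Adj x y then 1 else 0

theorem upEdges_nonneg : 0 ≤ upEdges v i H y :=
  Finset.sum_nonneg fun x _ => by split_ifs <;> norm_num

/-- The number of lanes: edges crossing from one of the balls of radius `2 q ≤ i < 3 q` into the
next sphere whose upper end survives another `q` steps outside that ball. -/
def lanes (v : V) (q : ℕ) (H : SimpleGraph V) : ℝ :=
  ∑ i ∈ Finset.Ico (2 * q) (3 * q), ∑ y, upEdges v i H y *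
    if (sphere (avoiding H (ball H v i)) y q).Nonempty then 1 else 0

theorem lanes_nonneg : 0 ≤ lanes v q H :=
  Finset.sum_nonneg fun i _ => Finset.sum_nonneg fun y _ =>
    mul_nonneg upEdges_nonneg (by split_ifs <;> norm_num)

/-- The number of vertices in the spheres of radius `q < j ≤ 2 q`. -/
def shellCard (v : V) (q : ℕ) (H : SimpleGraph V) : ℝ :=
  ∑ i ∈ Finset.Ico q (2 * q), ((sphere H v (i + 1)).ncard : ℝ)

/-- Each level separating an edge makes that edge a lane and contributes `1 / q ^ 2`; the factor `2`
counts both orientations. -/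
theorem dirichlet_laneFun_le : dirichlet H (laneFun H v q) ≤ 2 * lanes v q H / q ^ 2 := by
  set c : ℕ → V → V → ℝ := fun i x y =>
    if H.Adj x y ∧ Escapes H v (4 * q) i y ∧ ¬ Escapes H v (4 * q) i x then 1 else 0 with hc
  have h1 : dirichlet H (laneFun H v q) =
      (∑ i ∈ Finset.Ico (2 * q) (3 * q), ∑ x, ∑ y, (c i x y + c i y x)) / q ^ 2 := by
    have h2 : ∑ i ∈ Finset.Ico (2 * q) (3 * q), ∑ x, ∑ y, (c i x y + c i y x) =
        ∑ x, ∑ y, ∑ i ∈ Finset.Ico (2 * q) (3 * q), (c i x y + c i y x) := by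
      rw [Finset.sum_comm]
      exact Finset.sum_congr rfl fun x _ => Finset.sum_comm
    rw [h2, dirichlet, Finset.sum_div]
    refine Finset.sum_congr rfl fun x _ => ?_
    rw [Finset.sum_div]
    refine Finset.sum_congr rfl fun y _ => ?_
    by_cases hxy : H.Adj x y
    · rw [if_pos hxy, sq_laneFun_sub hxy]
      simp only [hc, hxy, hxy.symm, true_and]
    · have hyx : ¬ H.Adj y x := fun h => hxy h.symm
      simp [hc, hxy, hyx]
  have h2 : ∀ i, ∑ x, ∑ y, (c i x y + c i y x) = 2 * ∑ y, ∑ x, c i x y := by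
    intro i
    simp only [Finset.sum_add_distrib, two_mul]
    rw [Finset.sum_comm]
  rw [h1]
  simp only [h2, ← Finset.mul_sum]
  refine div_le_div_of_nonneg_right (mul_le_mul_of_nonneg_left ?_ (by norm_num)) (by positivity)
  refine Finset.sum_le_sum fun i hi => Finset.sum_le_sum fun y _ => ?_
  rw [upEdges, Finset.sum_mul]
  refine Finset.sum_le_sum fun x _ => ?_
  simp only [hc]
  split_ifs with h3 h4 h5 h5
  · norm_num
  · exfalso
    refine h5 (h3.2.1.sphere_nonempty ?_ ?_)
    · exact mem_ball_of_adj h4.1 h3.1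
    · have := (Finset.mem_Ico.1 hi).2
      omega
  all_goals first
    | exact absurd ⟨h3.2.1.mem_ball_of_not h3.1 h3.2.2, h3.2.1.mem_sphere_of_not h3.1 h3.2.2,
        h3.1⟩ h4
    | norm_num

theorem sum_subtype_le {S : Type*} [Fintype S] {e : S → V} (he : Function.Injective e)
    {g : V → ℝ} (hg : ∀ x, 0 ≤ g x) : ∑ x, g (e x) ≤ ∑ x, g x := by
  rw [← Finset.sum_image (s := Finset.univ) (g := e) (f := g) he.injOn]
  exact Finset.sum_le_sum_of_subset_of_nonneg (Finset.subset_univ _) fun x _ _ => hg x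

theorem dirichlet_toSimpleGraph_le (C : H.ConnectedComponent) (f : V → ℝ) :
    dirichlet C.toSimpleGraph (fun x => f x) ≤ dirichlet H f := by
  unfold dirichlet
  refine le_trans (Finset.sum_le_sum fun x _ => ?_) (sum_subtype_le Subtype.val_injective
    (g := fun x => ∑ y, if H.Adj x y then (f x - f y) ^ 2 else 0) fun x =>
      Finset.sum_nonneg fun y _ => by split_ifs <;> positivity)
  refine le_trans (Finset.sum_le_sum fun y _ => ?_) (sum_subtype_le Subtype.val_injective
    (g := fun y => if H.Adj x y then (f x - f y) ^ 2 else 0) fun y => by split_ifs <;> positivity)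
  exact le_rfl

theorem deg_toSimpleGraph_le (C : H.ConnectedComponent) (x : C) :
    (deg C.toSimpleGraph x : ℝ) ≤ ∑ y, if H.Adj x y then 1 else 0 := by
  rw [deg_eq_sum]
  exact sum_subtype_le Subtype.val_injective
    (g := fun y => if H.Adj x y then (1 : ℝ) else 0) fun y => by split_ifs <;> norm_num

/-- The handshake lemma in the graph formed by the edges inside the larger ball. -/
theorem sum_adj_ball_le (k : ℕ) :
    ∑ x, (if x ∈ ball H v k then ∑ y, (if H.Adj x y then (1 : ℝ) else 0) else 0) ≤
      2 * (edgesIn H (ball H v (k + 1))).ncard := by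
  have h1 : ∀ x, (if x ∈ ball H v k then ∑ y, (if H.Adj x y then (1 : ℝ) else 0) else 0) ≤
      deg (SimpleGraph.fromEdgeSet (edgesIn H (ball H v (k + 1)))) x := by
    intro x
    split_ifs with hx
    · rw [deg_eq_sum]
      refine Finset.sum_le_sum fun y _ => ?_
      by_cases hxy : H.Adj x y
      · rw [if_pos hxy, if_pos]
        refine (SimpleGraph.fromEdgeSet_adj _).2 ⟨⟨hxy, fun z hz => ?_⟩, hxy.ne⟩
        rcases Sym2.mem_iff.1 hz with rfl | rfl
        · exact ball_mono_radius (Nat.le_succ k) hx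
        · exact mem_ball_of_adj hx hxy
      · rw [if_neg hxy]
        split_ifs <;> norm_num
    · exact Nat.cast_nonneg _
  refine (Finset.sum_le_sum fun x _ => h1 x).trans ((sum_degW (K := _)).le.trans ?_)
  rw [SimpleGraph.edgeSet_fromEdgeSet]
  have := Set.ncard_le_ncard (Set.sdiff_subset (s := edgesIn H (ball H v (k + 1)))
    (t := Sym2.diagSet)) (Set.toFinite _)
  have : (((edgesIn H (ball H v (k + 1)) \ Sym2.diagSet).ncard : ℕ) : ℝ) ≤
    (edgesIn H (ball H v (k + 1))).ncard := by exact_mod_cast this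
  linarith

theorem shellCard_le : shellCard v q H ≤ ∑ x, if x ∈ ball H v (2 * q) then (1 : ℝ) else 0 := by
  have h1 : ∀ i, ((sphere H v (i + 1)).ncard : ℝ) =
      ∑ x, if x ∈ sphere H v (i + 1) then 1 else 0 := by
    intro i
    rw [Finset.sum_boole, ← Set.ncard_coe_finset]
    congr 2
    ext x
    simp
  simp only [shellCard, h1]
  rw [Finset.sum_comm]
  refine Finset.sum_le_sum fun x _ => ?_
  by_cases hx : ∃ i ∈ Finset.Ico q (2 * q), x ∈ sphere H v (i + 1)
  · obtain ⟨i, hi, hxi⟩ := hx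
    rw [Finset.sum_eq_single_of_mem i hi, if_pos hxi, if_pos]
    · have := (Finset.mem_Ico.1 hi).2
      exact ball_mono_radius (by omega) (mem_sphere_succ.1 hxi).1
    · intro j _ hj
      refine if_neg fun hxj => hj ?_
      have h2 := hxi.2
      have h3 := hxj.2
      omega
  · push Not at hx
    rw [Finset.sum_eq_zero fun i hi => if_neg (hx i hi)]
    split_ifs <;> norm_num

/-- The mixing time is at least the volume of the shell times the resistance of the lanes. -/
theorem shellCard_mul_le_compMix_mul {C : H.ConnectedComponent} (hv : v ∈ C.supp)
    (hC : 1 < compCard C) (hq : 0 < q)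
    (hball : 4 * ((edgesIn H (ball H v (5 * q))).ncard : ℝ) ≤ compEdges C) :
    q ^ 2 * shellCard v q H ≤ compMix C * lanes v q H := by
  have hnt := nontrivial_of_one_lt_compCard hC
  have hconn := C.connected_toSimpleGraph
  have h1 := sum_degW_mul_sq_le_mixingTime_mul hconn (f := fun x : C => laneFun H v q x)
    (B := {x : C | (x : V) ∈ ball H v (4 * q)}) (fun x hx => laneFun_eq_zero hx) ?_
  · have h2 : shellCard v q H ≤ ∑ x : C, (deg C.toSimpleGraph x : ℝ) * laneFun H v q x ^ 2 := by
      refine shellCard_le.trans ?_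
      have h3 : (∑ x, if x ∈ ball H v (2 * q) then (1 : ℝ) else 0) =
          ∑ x : C, if (x : V) ∈ ball H v (2 * q) then (1 : ℝ) else 0 := by
        rw [← Finset.sum_image (s := Finset.univ) (g := fun x : C => (x : V))
          (f := fun x => if x ∈ ball H v (2 * q) then (1 : ℝ) else 0)
          Subtype.val_injective.injOn]
        symm
        refine Finset.sum_subset (Finset.subset_univ _) fun x _ hx => if_neg fun hxb => hx ?_
        have : x ∈ C.supp := by rw [supp_eq_cluster hv]; exact hxb.1
        exact Finset.mem_image.2 ⟨⟨x, this⟩, Finset.mem_univ _, rfl⟩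
      rw [h3]
      refine Finset.sum_le_sum fun x _ => ?_
      split_ifs with hx
      · rw [laneFun_eq_one hq hx, one_pow, mul_one]
        exact_mod_cast deg_pos hconn x
      · positivity
    have h4 := (dirichlet_toSimpleGraph_le C (laneFun H v q)).trans dirichlet_laneFun_le
    have hq' : (0 : ℝ) < q ^ 2 := by positivity
    have h5 : shellCard v q H ≤ compMix C / 2 * (2 * lanes v q H / q ^ 2) :=
      h2.trans (h1.trans (mul_le_mul_of_nonneg_left h4 (by positivity)))
    calc q ^ 2 * shellCard v q H ≤ q ^ 2 * (compMix C / 2 * (2 * lanes v q H / q ^ 2)) :=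
          mul_le_mul_of_nonneg_left h5 hq'.le
      _ = compMix C * lanes v q H := by field_simp
  -- The degrees in `B(v, 4q)` sum to at most twice the edges in `B(v, 5q)`, hence to at most half
  -- the edges of `C`: a quarter of the total degree.
  · have h2 : ∑ x : C with x ∈ {x : C | (x : V) ∈ ball H v (4 * q)},
        (deg C.toSimpleGraph x : ℝ) ≤
        ∑ x, (if x ∈ ball H v (4 * q) then ∑ y, (if H.Adj x y then (1 : ℝ) else 0) else 0) := by
      rw [Finset.sum_filter]
      refine le_trans (Finset.sum_le_sum fun x _ => ?_) (sum_subtype_le Subtype.val_injective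
        (g := fun x => if x ∈ ball H v (4 * q) then
          ∑ y, (if H.Adj x y then (1 : ℝ) else 0) else 0) fun x => ?_)
      · simp only [Set.mem_ofPred_eq]
        split_ifs
        · exact deg_toSimpleGraph_le C x
        · exact le_rfl
      · split_ifs
        · exact Finset.sum_nonneg fun y _ => by split_ifs <;> norm_num
        · exact le_rfl
    have h3 : (edgesIn H (ball H v (4 * q + 1))).ncard ≤ (edgesIn H (ball H v (5 * q))).ncard :=
      Set.ncard_le_ncard (edgesIn_mono (ball_mono_radius (by omega))) (Set.toFinite _)
    have h3 : ((edgesIn H (ball H v (4 * q + 1))).ncard : ℝ) ≤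
      (edgesIn H (ball H v (5 * q))).ncard := by exact_mod_cast h3
    have h4 := sum_adj_ball_le (H := H) (v := v) (4 * q)
    rw [compEdges_eq] at hball
    linarith

end Lanes

/-! ### Few lanes and thick shells are typical -/

section LaneProbability
open Classical

variable {V : Type*} {G H : SimpleGraph V} {p : unitInterval} {c₁ c₂ : ℝ} {v : V}
  {i q : ℕ}

theorem CriticalBounds.percProb_avoiding_le (hG : CriticalBounds G p c₁ c₂) (hq : 0 < q)
    (S : Set V) (y : V) :
    percProb (avoiding G S) p {H | (sphere H y q).Nonempty} ≤ c₂ / q :=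
  (hG _ (avoiding_le G S) y q hq).2

/-- The uniform weights on the sphere of radius `i + 1`. -/
def sphereWeight (v : V) (i : ℕ) (H : SimpleGraph V) (y : V) : ℝ :=
  if y ∈ sphere H v (i + 1) then ((sphere H v (i + 1)).ncard : ℝ)⁻¹ else 0

theorem sphereWeight_nonneg (y : V) : 0 ≤ sphereWeight v i H y := by
  unfold sphereWeight
  split_ifs <;> positivity

variable [Fintype V]

theorem upEdges_touching (y : V) :
    upEdges v i (touching H (ball H v i)) y = upEdges v i H y := by
  unfold upEdges
  refine Finset.sum_congr rfl fun x _ => ?_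
  rw [ball_touching_ball (Nat.le_succ i), sphere_touching_ball]
  by_cases hx : x ∈ ball H v i
  · have : (touching H (ball H v i)).Adj x y ↔ H.Adj x y :=
      ⟨fun h => h.1, fun h => ⟨h, .inl hx⟩⟩
    simp only [this]
  · simp [hx]

/-- An edge from the ball of radius `i` to the next sphere determines both its level and its
orientation, so no edge is counted twice. -/
theorem sum_upEdges_le (s : Finset ℕ) {k : ℕ} (hs : ∀ i ∈ s, i < k) :
    ∑ i ∈ s, ∑ y, upEdges v i H y ≤ (edgesIn H (ball H v k)).ncard := by
  simp only [upEdges]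
  have h1 : ∀ i, (∑ y, ∑ x, if x ∈ ball H v i ∧ y ∈ sphere H v (i + 1) ∧ H.Adj x y
      then (1 : ℝ) else 0) = ∑ z : V × V, if z.1 ∈ ball H v i ∧ z.2 ∈ sphere H v (i + 1) ∧
        H.Adj z.1 z.2 then (1 : ℝ) else 0 := by
    intro i
    rw [Finset.sum_comm, ← Finset.sum_product', Finset.univ_product_univ]
  simp only [h1]
  rw [← Finset.sum_product', Finset.sum_boole]
  refine Nat.cast_le.2 ?_
  rw [← Set.ncard_coe_finset]
  refine Set.ncard_le_ncard_of_injOn (t := edgesIn H (ball H v k))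
    (fun z : ℕ × V × V => s(z.2.1, z.2.2)) ?_ ?_ (Set.toFinite _)
  · rintro ⟨i, x, y⟩ hz
    simp only [Finset.coe_filter, Set.mem_ofPred_eq, Finset.mem_product, Finset.mem_univ,
      and_true] at hz
    obtain ⟨hi, hx, hy, hxy⟩ := hz
    have := hs i hi
    refine ⟨hxy, fun w hw => ?_⟩
    rcases Sym2.mem_iff.1 hw with rfl | rfl
    · exact ball_mono_radius (by omega) hx
    · exact ball_mono_radius (by omega) (mem_sphere_succ.1 hy).1
  · rintro ⟨i, x, y⟩ hz ⟨j, x', y'⟩ hz' h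
    simp only [Finset.coe_filter, Set.mem_ofPred_eq, Finset.mem_product, Finset.mem_univ,
      and_true] at hz hz'
    obtain ⟨hi, hx, hy, -⟩ := hz
    obtain ⟨hj, hx', hy', -⟩ := hz'
    have e1 := hx.2
    have e2 := hy.2
    have e3 := hx'.2
    have e4 := hy'.2
    rcases Sym2.eq_iff.1 h with ⟨h1, h2⟩ | ⟨h1, h2⟩
    · simp only at h1 h2
      subst h1 h2
      have : i = j := by omega
      rw [this]
    · simp only at h1 h2
      subst h1 h2
      omega

/-- At most `3 c₁ q` candidate edges are expected, and the upper end of each survives with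
conditional probability at most `c₂ / q`. -/
theorem CriticalBounds.percExp_lanes_le (hG : CriticalBounds G p c₁ c₂) (hc₂ : 0 < c₂)
    (hq : 0 < q) : percExp G p (lanes v q) ≤ 3 * c₁ * c₂ := by
  have hq' : (0 : ℝ) < q := Nat.cast_pos.2 hq
  have h1 : percExp G p (lanes v q) ≤
      c₂ / q * percExp G p (fun H => ∑ i ∈ Finset.Ico (2 * q) (3 * q), ∑ y, upEdges v i H y) := by
    unfold lanes
    rw [percExp_sum, percExp_sum, Finset.mul_sum]
    exact Finset.sum_le_sum fun i _ => percExp_survival_le (hG.percProb_avoiding_le hq)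
      (upEdges v i) (fun _ _ => upEdges_nonneg) fun _ _ => upEdges_touching _
  have h2 : percExp G p (fun H => ∑ i ∈ Finset.Ico (2 * q) (3 * q), ∑ y, upEdges v i H y) ≤
      c₁ * (3 * q : ℕ) :=
    (percExp_mono fun H _ => sum_upEdges_le _ fun i hi => (Finset.mem_Ico.1 hi).2).trans
      (hG G le_rfl v (3 * q) (by omega)).1
  refine h1.trans ((mul_le_mul_of_nonneg_left h2 (by positivity)).trans (le_of_eq ?_))
  push_cast
  field_simp

theorem sum_sphereWeight :
    ∑ y, sphereWeight v i H y = if (sphere H v (i + 1)).Nonempty then 1 else 0 := by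
  unfold sphereWeight
  rw [← Finset.sum_filter, Finset.sum_const, nsmul_eq_mul]
  have h1 : (Finset.univ.filter (· ∈ sphere H v (i + 1))).card = (sphere H v (i + 1)).ncard := by
    rw [← Set.ncard_coe_finset]
    congr 1
    ext
    simp
  rw [h1]
  split_ifs with h
  · have := (Set.ncard_pos (Set.toFinite _)).2 h
    exact mul_inv_cancel₀ (by exact_mod_cast this.ne')
  · rw [Set.not_nonempty_iff_eq_empty.1 h]
    simp

/-- A cluster which survives for `3 q` steps is unlikely to have thin shells. -/
theorem CriticalBounds.percProb_shellCard_le (hG : CriticalBounds G p c₁ c₂) (hc₂ : 0 < c₂)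
    (hq : 0 < q) {m : ℝ} (hm : 0 < m) :
    percProb G p {H | (sphere H v (3 * q)).Nonempty ∧ shellCard v q H ≤ m} ≤
      m * c₂ ^ 2 / q ^ 3 := by
  have hq' : (0 : ℝ) < q := Nat.cast_pos.2 hq
  set F : SimpleGraph V → ℝ := fun H => ∑ i ∈ Finset.Ico q (2 * q), ∑ y, sphereWeight v i H y *
    if (sphere (avoiding H (ball H v i)) y q).Nonempty then 1 else 0 with hF
  have hF0 : ∀ H, 0 ≤ F H := fun H => Finset.sum_nonneg fun i _ => Finset.sum_nonneg fun y _ =>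
    mul_nonneg (sphereWeight_nonneg y) (by split_ifs <;> norm_num)
  -- At each of the `q` levels: reaching the sphere costs `c₂ / q`, and a uniformly chosen vertex of
  -- it survives with conditional probability at most `c₂ / q`.
  have hFexp : percExp G p F ≤ c₂ ^ 2 / q := by
    rw [hF, percExp_sum]
    have h1 : ∀ i ∈ Finset.Ico q (2 * q), percExp G p (fun H => ∑ y, sphereWeight v i H y *
        if (sphere (avoiding H (ball H v i)) y q).Nonempty then 1 else 0) ≤
          c₂ / q * (c₂ / q) := by
      intro i hi
      refine (percExp_survival_le (hG.percProb_avoiding_le hq) (sphereWeight v i)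
        (fun _ _ => sphereWeight_nonneg _) fun H y => ?_).trans
          (mul_le_mul_of_nonneg_left ?_ (by positivity))
      · unfold sphereWeight
        rw [sphere_touching_ball]
      · simp only [sum_sphereWeight]
        have h2 := (hG G le_rfl v (i + 1) (by omega)).2
        rw [percProb_eq_percExp] at h2
        refine h2.trans ?_
        have := (Finset.mem_Ico.1 hi).1
        gcongr
        omega
    refine (Finset.sum_le_sum h1).trans (le_of_eq ?_)
    rw [Finset.sum_const, Nat.card_Ico, show 2 * q - q = q by omega, nsmul_eq_mul]
    field_simp
  have hdiv : (0 : ℝ) < q ^ 2 / m := by positivity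
  refine (percProb_le_div (f := F) hdiv (fun H _ => hF0 H) ?_).trans
    ((div_le_div_of_nonneg_right hFexp hdiv.le).trans (le_of_eq ?_))
  · rintro H _ ⟨⟨z, hz, hzd⟩, hsm⟩
    have hpos : ∀ i ∈ Finset.Ico q (2 * q), (0 : ℝ) < (sphere H v (i + 1)).ncard := by
      intro i hi
      have := (Finset.mem_Ico.1 hi).2
      exact Nat.cast_pos.2 ((Set.ncard_pos (Set.toFinite _)).2
        (sphere_nonempty_of_le_dist hz (by omega)))
    have h1 : ∀ i ∈ Finset.Ico q (2 * q), 1 ^ 2 / ((sphere H v (i + 1)).ncard : ℝ) ≤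
        ∑ y, sphereWeight v i H y *
          if (sphere (avoiding H (ball H v i)) y q).Nonempty then 1 else 0 := by
      intro i hi
      have hi2 := (Finset.mem_Ico.1 hi).2
      obtain ⟨y, hy, hyz⟩ := exists_sphere_reachable (i := i) hz fun h => by
        have := h.2
        omega
      refine le_trans (le_of_eq ?_) (Finset.single_le_sum (fun y _ =>
        mul_nonneg (sphereWeight_nonneg y) (by split_ifs <;> norm_num)) (Finset.mem_univ y))
      have hs : (sphere (avoiding H (ball H v i)) y q).Nonempty := by
        refine sphere_nonempty_of_reachable (b := 3 * q - 1) (avoiding_le _ _)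
          (mem_sphere_succ.1 hy).1 hyz (fun h => ?_) (by omega)
        have := h.2
        omega
      rw [if_pos hs, sphereWeight, if_pos hy, mul_one, one_pow, one_div]
    -- At each level some vertex survives, so `F` is at least the sum of the inverse sphere sizes;
    -- by Cauchy-Schwarz a thin shell makes this large.
    have h2 := Finset.sq_sum_div_le_sum_sq_div (Finset.Ico q (2 * q)) (fun _ => (1 : ℝ)) hpos
    have h3 : (∑ _i ∈ Finset.Ico q (2 * q), (1 : ℝ)) = q := by
      rw [Finset.sum_const, Nat.card_Ico, show 2 * q - q = q by omega, nsmul_one]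
    rw [h3] at h2
    have h4 : 0 < shellCard v q H :=
      Finset.sum_pos hpos (Finset.nonempty_Ico.2 (by omega))
    calc (q : ℝ) ^ 2 / m ≤ q ^ 2 / shellCard v q H := by gcongr
      _ ≤ F H := h2.trans (Finset.sum_le_sum h1)
  · field_simp

/-- Large components with a small mixing time are unlikely. -/
theorem CriticalBounds.percProb_compMix_le (hG : CriticalBounds G p c₁ c₂) (hc₂ : 0 < c₂)
    (hq : 0 < q) {M m l : ℝ} (hM : 1 ≤ M) (hm : 0 < m) (hl : 0 < l) :
    percProb G p {H | ∃ C : H.ConnectedComponent, M < compCard C ∧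
      compMix C < q ^ 2 * m / l} ≤
      Fintype.card V * (40 * c₁ * q / M + 3 * c₁ * c₂ / l + m * c₂ ^ 2 / q ^ 3) / M := by
  have hM0 : 0 < M := by linarith
  have hq' : (0 : ℝ) < q := Nat.cast_pos.2 hq
  refine (percProb_mono ?_).trans (percProb_exists_component_le
    (Bad := fun H v => (M / 8 ≤ (edgesIn H (ball H v (5 * q))).ncard ∨ l ≤ lanes v q H) ∨
      (sphere H v (3 * q)).Nonempty ∧ shellCard v q H ≤ m) hM0 fun v => ?_)
  · rintro H _ ⟨C, hC, hmix⟩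
    refine ⟨C, hC, fun v hv => ?_⟩
    by_contra hcon
    push Not at hcon
    obtain ⟨⟨h1, h2⟩, h3⟩ := hcon
    have hC1 : 1 < compCard C := by exact_mod_cast hM.trans_lt hC
    have h4 : compCard C ≤ 2 * compEdges C := by
      have := compCard_le C
      omega
    have h4 : (compCard C : ℝ) ≤ 2 * compEdges C := by exact_mod_cast h4
    have h5 := shellCard_mul_le_compMix_mul hv hC1 hq (by linarith)
    -- Otherwise the whole component would lie in `B(v, 5q)`, which has too few edges.
    have h6 : (sphere H v (3 * q)).Nonempty := by
      by_contra hs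
      have h7 : compEdges C ≤ (edgesIn H (ball H v (5 * q))).ncard := by
        rw [compEdges, supp_eq_cluster hv]
        exact Set.ncard_le_ncard (edgesIn_mono ((cluster_subset_ball hs).trans
          (ball_mono_radius (by omega)))) (Set.toFinite _)
      have h7 : (compEdges C : ℝ) ≤ (edgesIn H (ball H v (5 * q))).ncard := by exact_mod_cast h7
      linarith
    have h7 := h3 h6
    have h8 : (compMix C : ℝ) * lanes v q H ≤ compMix C * l :=
      mul_le_mul_of_nonneg_left h2.le (Nat.cast_nonneg _)
    have h9 : (q : ℝ) ^ 2 * m < q ^ 2 * shellCard v q H :=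
      mul_lt_mul_of_pos_left h7 (by positivity)
    rw [lt_div_iff₀ hl] at hmix
    linarith
  · refine (percProb_le_add (T := {H | M / 8 ≤ (edgesIn H (ball H v (5 * q))).ncard ∨
      l ≤ lanes v q H}) (U := {H | (sphere H v (3 * q)).Nonempty ∧ shellCard v q H ≤ m})
      fun H _ h => h).trans (add_le_add ((percProb_le_add
        (T := {H | M / 8 ≤ (edgesIn H (ball H v (5 * q))).ncard}) (U := {H | l ≤ lanes v q H})
        fun H _ h => h).trans (add_le_add ?_ ?_)) (hG.percProb_shellCard_le hc₂ hq hm))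
    · refine (hG.percProb_edges_le le_rfl v (by omega) (by positivity)).trans (le_of_eq ?_)
      push_cast
      field_simp
      ring
    · exact (percProb_le_div hl (fun _ _ => lanes_nonneg) fun _ _ h => h).trans
        (div_le_div_of_nonneg_right (hG.percExp_lanes_le hc₂ hq) hl.le)

end LaneProbability

/-! ### Critical scaling, with `s = n^(1/3)` -/

section Scaling

variable {V : Type*} [Fintype V] {G : SimpleGraph V} {p : unitInterval} {c₁ c₂ β s A : ℝ}

/-- A bound with the exponent `1` is trivial for small `A`. -/
theorem percProb_le_mul_inv {S : Set (SimpleGraph V)} {K : ℝ} (hA : 0 < A) (h : A ≤ K) :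
    percProb G p S ≤ K * A⁻¹ := by
  refine (percProb_le_one S).trans ?_
  rw [← div_eq_mul_inv]
  exact (one_le_div hA).2 h

theorem CriticalBounds.percProb_edges_scaled_le (hG : CriticalBounds G p c₁ c₂) (hc₁ : 0 < c₁)
    (hc₂ : 0 < c₂) (hs : 1 ≤ s) (hV : (Fintype.card V : ℝ) = s ^ 3) (hA : 0 < A) :
    percProb G p {H | ∃ C : H.ConnectedComponent, A * s ^ 2 < compEdges C} ≤
      (2 + 2 * c₁ * (c₂ + 8 * c₁)) * A⁻¹ := by
  rcases le_or_gt A 2 with h2 | h2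
  · exact percProb_le_mul_inv hA (h2.trans (le_add_of_nonneg_right (by positivity)))
  have hM : 2 ≤ A * s ^ 2 := by nlinarith [one_le_pow₀ hs (n := 2)]
  refine (hG.percProb_edges_gt_le hc₁ hc₂ hM).trans ?_
  have hsq : s ≤ √(A * s ^ 2) := by
    refine Real.le_sqrt_of_sq_le ?_
    nlinarith [one_le_pow₀ hs (n := 2)]
  have hD : 0 < 2 * c₁ * (c₂ + 8 * c₁) := by positivity
  set D := 2 * c₁ * (c₂ + 8 * c₁)
  have hs0 : 0 < s := by linarith
  calc Fintype.card V * D / (√(A * s ^ 2) * (A * s ^ 2)) ≤ s ^ 3 * D / (s * (A * s ^ 2)) := by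
        rw [hV]
        gcongr
    _ = D * A⁻¹ := by field_simp
    _ ≤ (2 + D) * A⁻¹ := by
        gcongr
        linarith

theorem CriticalBounds.percProb_diam_gt_scaled_le (hG : CriticalBounds G p c₁ c₂)
    (hc₂ : 0 < c₂) (hβ : 0 < β) (hs : 1 ≤ s) (hV : (Fintype.card V : ℝ) = s ^ 3) (hA : 0 < A) :
    percProb G p {H | ∃ C : H.ConnectedComponent, β * s ^ 2 < compCard C ∧ A * s < compDiam C} ≤
      2 * c₂ / β * A⁻¹ := by
  have hs0 : 0 < s := by linarith
  refine (hG.percProb_diam_gt_le hc₂ (by positivity) (by positivity)).trans (le_of_eq ?_)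
  rw [hV]
  field_simp

theorem CriticalBounds.percProb_diam_scaled_le (hG : CriticalBounds G p c₁ c₂) (hc₁ : 0 < c₁)
    (hc₂ : 0 < c₂) (hβ : 0 < β) (hs : 1 ≤ s) (hV : (Fintype.card V : ℝ) = s ^ 3) (hA : 0 < A)
    (hβs : 1 ≤ β * s ^ 2) :
    percProb G p {H | ∃ C : H.ConnectedComponent, β * s ^ 2 < compCard C ∧
      (compDiam C : ℝ) ∉ Set.Icc (A⁻¹ * s) (A * s)} ≤ (2 * c₂ / β + 4 * c₁ / β ^ 2) * A⁻¹ := by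
  have hs0 : 0 < s := by linarith
  rw [add_mul]
  refine (percProb_le_add ?_).trans (add_le_add
    (hG.percProb_diam_gt_scaled_le hc₂ hβ hs hV hA)
    ((hG.percProb_diam_lt_le hc₁ hβs (R := A⁻¹ * s) (by positivity)).trans (le_of_eq ?_)))
  · rintro H _ ⟨C, hC, hd⟩
    rw [Set.mem_Icc, not_and_or, not_le, not_le] at hd
    rcases hd with hd | hd
    · exact .inr ⟨C, hC, hd⟩
    · exact .inl ⟨C, hC, hd⟩
  · rw [hV]
    field_simp

theorem CriticalBounds.percProb_compMix_gt_scaled_le (hG : CriticalBounds G p c₁ c₂)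
    (hc₁ : 0 < c₁) (hc₂ : 0 < c₂) (hβ : 0 < β) (hs : 1 ≤ s)
    (hV : (Fintype.card V : ℝ) = s ^ 3) (hA : 0 < A) :
    percProb G p {H | ∃ C : H.ConnectedComponent, β * s ^ 2 < compCard C ∧
      A ^ 2 * s ^ 3 < compMix C} ≤
        8 * ((2 + 2 * c₁ * (c₂ + 8 * c₁)) + 2 * c₂ / β) * A⁻¹ := by
  have hs0 : 0 < s := by linarith
  -- Two factors `A / 8` cancel the constant `64` and leave `A ^ 2`, which is why the exponent of
  -- `A` is halved in the end.
  have h1 := hG.percProb_edges_scaled_le hc₁ hc₂ hs hV (A := A / 8) (by positivity)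
  have h2 := hG.percProb_diam_gt_scaled_le hc₂ hβ hs hV (A := A / 8) (by positivity)
  refine (percProb_le_add ?_).trans ((add_le_add h1 h2).trans (le_of_eq ?_))
  · rintro H _ ⟨C, hC, hmix⟩
    by_contra hcon
    simp only [Set.mem_ofPred_eq, not_or, not_exists, not_lt, not_and] at hcon
    have h3 := hcon.1 C
    have h4 := hcon.2 C hC
    have h5 : (compMix C : ℝ) ≤ 64 * (compEdges C * compDiam C) := by
      have := compMix_le C
      rw [mul_assoc] at this
      exact_mod_cast this
    have h6 : (compEdges C : ℝ) * compDiam C ≤ A / 8 * s ^ 2 * (A / 8 * s) := by gcongr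
    nlinarith
  · rw [inv_div]
    ring

theorem CriticalBounds.percProb_compMix_lt_scaled_le (hG : CriticalBounds G p c₁ c₂)
    (hc₁ : 0 < c₁) (hc₂ : 0 < c₂) (hβ : 0 < β) (hs : 1 ≤ s)
    (hV : (Fintype.card V : ℝ) = s ^ 3) (hβs : 1 ≤ β * s ^ 2) {a : ℝ} (ha : 0 < a) :
    percProb G p {H | ∃ C : H.ConnectedComponent, β * s ^ 2 < compCard C ∧
      compMix C < a ^ 13 * s ^ 3} ≤
        (1 + (80 * c₁ / β + 3 * c₁ * c₂ + c₂ ^ 2) / β) * a := by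
  have hs0 : 0 < s := by linarith
  set D := (80 * c₁ / β + 3 * c₁ * c₂ + c₂ ^ 2) / β with hD
  have hD0 : 0 < D := by positivity
  rcases le_or_gt 1 a with ha1 | ha1
  · refine (percProb_le_one _).trans ?_
    nlinarith
  -- Nontrivial components have mixing time at least `1`, so a threshold of at most `1` makes the
  -- event empty. Otherwise `a * s > 1`, and rounding `q` up at most doubles it.
  rcases le_or_gt (a ^ 13 * s ^ 3) 1 with h1 | h1
  · rw [percProb_eq_zero]
    · positivity
    · rintro H _ ⟨C, hC, hmix⟩
      have h2 : 1 < compCard C := by exact_mod_cast hβs.trans_lt hC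
      have h3 : (1 : ℝ) ≤ compMix C := by exact_mod_cast compMix_pos h2
      linarith
  have has : 1 < a * s := by
    by_contra hcon
    have h2 : (a * s) ^ 3 ≤ 1 := pow_le_one₀ (by positivity) (by linarith)
    have h3 : a ^ 10 ≤ 1 := pow_le_one₀ ha.le ha1.le
    have h4 : a ^ 13 * s ^ 3 = a ^ 10 * (a * s) ^ 3 := by ring
    have h5 : a ^ 10 * (a * s) ^ 3 ≤ 1 := mul_le_one₀ h3 (by positivity) h2
    linarith
  set q := ⌈a * s⌉₊ with hqdef
  have hq : 0 < q := Nat.ceil_pos.2 (by positivity)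
  have hq1 : a * s ≤ q := Nat.le_ceil _
  have hq2 : (q : ℝ) ≤ 2 * (a * s) := by
    have : (q : ℝ) < a * s + 1 := Nat.ceil_lt_add_one (by positivity)
    linarith
  have hq0 : (0 : ℝ) < q := Nat.cast_pos.2 hq
  -- With these choices all three error terms are of order `a / s`, and `n / M = s / β` turns them
  -- into order `a`.
  have hmain := hG.percProb_compMix_le hc₂ hq hβs (m := a * q ^ 3 / s) (l := s / a)
    (by positivity) (by positivity)
  refine (percProb_mono ?_).trans (hmain.trans ?_)
  · rintro H _ ⟨C, hC, hmix⟩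
    refine ⟨C, hC, hmix.trans_le ?_⟩
    have h2 : (a * s) ^ 5 ≤ (q : ℝ) ^ 5 := by gcongr
    -- The threshold `q ^ 2 * m / l` is in fact at least `a ^ 7 * s ^ 3`.
    have h3 : a ^ 13 ≤ a ^ 7 := pow_le_pow_of_le_one ha.le ha1.le (by norm_num)
    calc a ^ 13 * s ^ 3 ≤ a ^ 7 * s ^ 3 := by gcongr
      _ = a ^ 2 / s ^ 2 * (a * s) ^ 5 := by field_simp
      _ ≤ a ^ 2 / s ^ 2 * q ^ 5 := by gcongr
      _ = q ^ 2 * (a * q ^ 3 / s) / (s / a) := by field_simp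
  · calc Fintype.card V * (40 * c₁ * q / (β * s ^ 2) + 3 * c₁ * c₂ / (s / a) +
          a * q ^ 3 / s * c₂ ^ 2 / q ^ 3) / (β * s ^ 2)
        ≤ s ^ 3 * (40 * c₁ * (2 * (a * s)) / (β * s ^ 2) + 3 * c₁ * c₂ / (s / a) +
          a * q ^ 3 / s * c₂ ^ 2 / q ^ 3) / (β * s ^ 2) := by
          rw [hV]
          gcongr
      _ = D * a := by
          rw [hD]
          field_simp
          ring
      _ ≤ (1 + D) * a := by nlinarith

end Scaling

end CriticalPercolation

end

/-! ### Assembly of the theorem -/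

open CriticalPercolation in
theorem theorem2p1 (c₁ c₂ β : ℝ) (hc₁ : 0 < c₁) (hc₂ : 0 < c₂) (hβ : 0 < β) :
    ∃ K : ℝ, 0 < K ∧
      ∀ (V : Type*) [Fintype V] (G : SimpleGraph V) (p : unitInterval), 0 < p → p < 1 →
        (∀ G' : SimpleGraph V, G' ≤ G → ∀ (v : V) (k : ℕ), 1 ≤ k →
          percExp G' p (fun H => ((edgesIn H (ball H v k)).ncard : ℝ)) ≤ c₁ * k ∧
          percProb G' p {H | (sphere H v k).Nonempty} ≤ c₂ / k) →
        ∀ (n : ℝ), n = Fintype.card V → ∀ A : ℝ, 0 < A →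
          (1 ≤ β * n ^ (2 / 3 : ℝ) →
            percProb G p {H | ∃ C : H.ConnectedComponent,
              β * n ^ (2 / 3 : ℝ) < compCard C ∧
              (compDiam C : ℝ) ∉ Set.Icc (A⁻¹ * n ^ (1 / 3 : ℝ)) (A * n ^ (1 / 3 : ℝ))}
            ≤ K * A⁻¹) ∧
          percProb G p {H | ∃ C : H.ConnectedComponent,
              A * n ^ (2 / 3 : ℝ) < compEdges C}
            ≤ K * A⁻¹ ∧
          percProb G p {H | ∃ C : H.ConnectedComponent,
              β * n ^ (2 / 3 : ℝ) < compCard C ∧ A * n < compMix C}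
            ≤ K * A ^ (-(1 / 2) : ℝ) ∧
          (1 ≤ β * n ^ (2 / 3 : ℝ) →
            percProb G p {H | ∃ C : H.ConnectedComponent,
              β * n ^ (2 / 3 : ℝ) < compCard C ∧ (compMix C : ℝ) < A⁻¹ * n}
            ≤ K * A ^ (-(1 / 13) : ℝ)) := by
  obtain ⟨K₁, hK₁⟩ : ∃ K, K = 2 * c₂ / β + 4 * c₁ / β ^ 2 := ⟨_, rfl⟩
  obtain ⟨K₂, hK₂⟩ : ∃ K, K = 2 + 2 * c₁ * (c₂ + 8 * c₁) := ⟨_, rfl⟩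
  obtain ⟨K₃, hK₃⟩ : ∃ K, K = 8 * ((2 + 2 * c₁ * (c₂ + 8 * c₁)) + 2 * c₂ / β) := ⟨_, rfl⟩
  obtain ⟨K₄, hK₄⟩ : ∃ K, K = 1 + (80 * c₁ / β + 3 * c₁ * c₂ + c₂ ^ 2) / β := ⟨_, rfl⟩
  have h₁ : 0 < K₁ := by rw [hK₁]; positivity
  have h₂ : 0 < K₂ := by rw [hK₂]; positivity
  have h₃ : 0 < K₃ := by rw [hK₃]; positivity
  have h₄ : 0 < K₄ := by rw [hK₄]; positivity
  refine ⟨K₁ + K₂ + K₃ + K₄, by positivity, ?_⟩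
  intro V _ G p _ _ hG n hn A hA
  have hle : ∀ {x K b : ℝ}, 0 ≤ b → K ≤ K₁ + K₂ + K₃ + K₄ → x ≤ K * b →
      x ≤ (K₁ + K₂ + K₃ + K₄) * b := fun hb hK hx =>
    hx.trans (mul_le_mul_of_nonneg_right hK hb)
  rcases isEmpty_or_nonempty V with hV | hV
  -- Without vertices there are no components, so all four events are empty; the scaled bounds need
  -- `s ≥ 1`.
  · have hC : ∀ (H : SimpleGraph V) (C : H.ConnectedComponent), False := fun H C => by
      obtain ⟨v, -⟩ := exists_mem_supp C
      exact hV.elim v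
    have h0 : ∀ Q : (H : SimpleGraph V) → H.ConnectedComponent → Prop,
        percProb G p {H | ∃ C, Q H C} = 0 := fun Q =>
      percProb_eq_zero fun H _ hH => hC H hH.choose
    refine ⟨fun _ => (h0 _).trans_le ?_, (h0 _).trans_le ?_, (h0 _).trans_le ?_,
      fun _ => (h0 _).trans_le ?_⟩ <;> positivity
  have hn1 : 1 ≤ n := by
    rw [hn]
    exact_mod_cast Fintype.card_pos
  obtain ⟨s, hs⟩ : ∃ s, s = n ^ (1 / 3 : ℝ) := ⟨_, rfl⟩
  have hs1 : 1 ≤ s := hs ▸ Real.one_le_rpow hn1 (by norm_num)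
  have hs3 : n = s ^ 3 := by
    rw [hs, ← Real.rpow_natCast, ← Real.rpow_mul (by linarith)]
    norm_num
  have hs2 : n ^ (2 / 3 : ℝ) = s ^ 2 := by
    rw [hs, ← Real.rpow_natCast, ← Real.rpow_mul (by linarith)]
    norm_num
  have hcard : (Fintype.card V : ℝ) = s ^ 3 := hn.symm.trans hs3
  have hG : CriticalBounds G p c₁ c₂ := hG
  rw [hs2, ← hs]
  have hA2 : A ^ (-(1 / 2) : ℝ) = (√A)⁻¹ := by
    rw [Real.rpow_neg hA.le, Real.sqrt_eq_rpow]
  -- The lower mixing bound is applied with `a = A ^ (-1/13)`.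
  have hA13 : A⁻¹ = (A ^ (-(1 / 13) : ℝ)) ^ 13 := by
    rw [← Real.rpow_natCast, ← Real.rpow_mul hA.le, ← Real.rpow_neg_one]
    norm_num
  refine ⟨fun hβs => ?_, ?_, ?_, fun hβs => ?_⟩
  · refine hle (K := K₁) (by positivity) (by linarith) ?_
    rw [hK₁]
    exact hG.percProb_diam_scaled_le hc₁ hc₂ hβ hs1 hcard hA hβs
  · refine hle (K := K₂) (by positivity) (by linarith) ?_
    rw [hK₂]
    exact hG.percProb_edges_scaled_le hc₁ hc₂ hs1 hcard hA
  · refine hle (K := K₃) (by positivity) (by linarith) ?_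
    rw [hK₃, hA2]
    have h := hG.percProb_compMix_gt_scaled_le hc₁ hc₂ hβ hs1 hcard (Real.sqrt_pos.2 hA)
    rwa [Real.sq_sqrt hA.le, ← hs3] at h
  · refine hle (K := K₄) (by positivity) (by linarith) ?_
    rw [hK₄]
    have h := hG.percProb_compMix_lt_scaled_le hc₁ hc₂ hβ hs1 hcard hβs
      (Real.rpow_pos_of_pos hA (-(1 / 13)))
    rwa [← hA13, ← hs3] at h
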